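/- Let $X$ be a compact connected Riemann surface, $S=\{x_1,\dots,x_m\}\subset X$ a finite set of distinct points, and $E$ a holomorphic vector bundle on $X$ of rank $n\ge 1$ and degree $d$ with $\gcd(n,d)=1$. A logarithmic connection on $E$ singular over $S$ is a $\mathbb{C}$-linear map of sheaves $D:E\to E\otimes\Omega^1_X(\log S)$ with $D(fs)=f\,D(s)+df\otimes s$ for local holomorphic functions $f$ and local holomorphic sections $s$; its residue $\mathrm{Res}(D,x_j)\in\mathrm{End}(E(x_j))$ sends $s(x_j)$ to $g(x_j)$ if $D(s)=g\otimes\frac{dt}{t}$ near $x_j$, where $t$ is a local coordinate centred at $x_j$. Suppose that $D$ is such a connection and that there are $\lambda_1,\dots,\lambda_m\in\mathbb{C}$ with $\mathrm{Res}(D,x_j)=\lambda_j\,\mathrm{Id}_{E(x_j)}$ for all $j$. Then $D$ is irreducible: if $F\subseteq E$ is a holomorphic subbundle with $D(F)\subseteq F\otimes\Omega^1_X(\log S)$, then $F=0$ or $F=E$. -/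

import Mathlib

open scoped Manifold ContDiff Topology Bundle
open Bundle

noncomputable section

namespace LogConn

variable {X : Type*} [TopologicalSpace X] [ChartedSpace ℂ X]

/-- The value at `y` of the differential `df` of a complex function `f` on `X`. -/
def diff (f : X → ℂ) (y : X) : TangentSpace 𝓘(ℂ, ℂ) y →ₗ[ℂ] ℂ :=
  ContinuousLinearMap.toLinearMap (M₂ := ℂ) (mfderiv 𝓘(ℂ, ℂ) 𝓘(ℂ, ℂ) f y)

open Classical in
/-- The local generator around `x` of the sheaf of logarithmic `1`-forms along `S`, by its value at
`y`: it is `dt / t` if `x ∈ S`, with `t` the preferred coordinate around `x` translated so that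
`t x = 0`, and `dt` if `x ∉ S`. -/
def logGen (S : Finset X) (x y : X) : TangentSpace 𝓘(ℂ, ℂ) y →ₗ[ℂ] ℂ :=
  if x ∈ S then (chartAt ℂ x y - chartAt ℂ x x)⁻¹ • diff (chartAt ℂ x) y else diff (chartAt ℂ x) y

variable (n : ℕ) (E : X → Type*)
  [∀ x, AddCommGroup (E x)] [∀ x, Module ℂ (E x)] [∀ x, TopologicalSpace (E x)]
  [TopologicalSpace (TotalSpace (Fin n → ℂ) E)]
  [FiberBundle (Fin n → ℂ) E]

variable {E} in
/-- `s` restricts to a holomorphic section of the bundle `E` over the open set `U`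
(the values of `s` outside `U` are irrelevant). -/
def IsHolSection (U : Set X) (s : ∀ x, E x) : Prop :=
  ContMDiffOn 𝓘(ℂ, ℂ) (𝓘(ℂ, ℂ).prod 𝓘(ℂ, Fin n → ℂ)) ω
    (fun x => TotalSpace.mk' (Fin n → ℂ) x (s x)) U

variable {E} in
/-- A family of subspaces `W x ⊆ E x` is a holomorphic subbundle of `E`: around every point there
are holomorphic sections of `E` which are linearly independent in every fibre and whose values
span `W` in every fibre. -/
def IsHolSubbundle (W : ∀ x, Submodule ℂ (E x)) : Prop :=
  ∀ x, ∃ (U : Set X) (r : ℕ) (s : Fin r → ∀ y, E y), IsOpen U ∧ x ∈ U ∧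
    (∀ i, IsHolSection n U (s i)) ∧
    ∀ y ∈ U, LinearIndependent ℂ (fun i => s i y) ∧
      Submodule.span ℂ (Set.range fun i => s i y) = W y

variable {E} in
/-- `η` restricts to a section over the open set `U` of `W ⊗ Ω¹(log S)`, where `W` is a
holomorphic subbundle of `E` (for instance `E` itself): locally it is `g ⊗ dt` (away from `S`) or
`g ⊗ dt / t` (around a point of `S`) with `g` a holomorphic section of `W`.
Such a section is determined by its values off `S`; the values of `η` on `S` and outside `U`
are irrelevant. -/
def IsLogForm (S : Finset X) (W : ∀ x, Submodule ℂ (E x)) (U : Set X)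
    (η : ∀ y, TangentSpace 𝓘(ℂ, ℂ) y →ₗ[ℂ] E y) : Prop :=
  ∀ x ∈ U, ∃ (V : Set X) (g : ∀ y, E y), IsOpen V ∧ x ∈ V ∧ IsHolSection n V g ∧
    (∀ y ∈ V, g y ∈ W y) ∧ ∀ y ∈ V, y ∉ S → η y = (logGen S x y).smulRight (g y)

/-- A logarithmic connection on `E` singular over `S`: a `ℂ`-linear map of sheaves
`D : E → E ⊗ Ω¹(log S)` satisfying the Leibniz identity `D (f s) = f D s + df ⊗ s`.
Local sections over an open set `U` are represented by total functions, so that `D s` has a meaning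
only on open sets on which `s` is holomorphic; `map_congr` says that `D s` on `U` depends
only on the restriction of `s` to `U`. -/
structure LogConnection (S : Finset X) where
  /-- the underlying map on local sections -/
  D : (∀ x, E x) → ∀ x, TangentSpace 𝓘(ℂ, ℂ) x →ₗ[ℂ] E x
  isLogForm : ∀ (U : Set X) (s : ∀ x, E x), IsOpen U → IsHolSection n U s →
    IsLogForm n S (fun _ => ⊤) U (D s)
  map_congr : ∀ (U : Set X) (s s' : ∀ x, E x), IsOpen U →
    IsHolSection n U s → IsHolSection n U s' → (∀ y ∈ U, s y = s' y) →
    ∀ y ∈ U, y ∉ S → D s y = D s' y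
  map_add : ∀ (U : Set X) (s s' : ∀ x, E x), IsOpen U →
    IsHolSection n U s → IsHolSection n U s' →
    ∀ y ∈ U, y ∉ S → D (fun z => s z + s' z) y = D s y + D s' y
  map_smul : ∀ (U : Set X) (c : ℂ) (s : ∀ x, E x), IsOpen U → IsHolSection n U s →
    ∀ y ∈ U, y ∉ S → D (fun z => c • s z) y = c • D s y
  leibniz : ∀ (U : Set X) (f : X → ℂ) (s : ∀ x, E x), IsOpen U →
    ContMDiffOn 𝓘(ℂ, ℂ) 𝓘(ℂ, ℂ) ω f U → IsHolSection n U s →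
    ∀ y ∈ U, y ∉ S → D (fun z => f z • s z) y = f y • D s y + (diff f y).smulRight (s y)

variable {n E}

/-- `Res(D, x) = R` for a point `x ∈ S`: if `D s = g ⊗ dt / t` around `x`, with `s` and `g`
holomorphic sections, then `R (s x) = g x`. -/
def LogConnection.HasResidue {S : Finset X} (D : LogConnection n E S) (x : X)
    (R : E x →ₗ[ℂ] E x) : Prop :=
  ∀ (V : Set X) (s g : ∀ y, E y), IsOpen V → x ∈ V → IsHolSection n V s → IsHolSection n V g →
    (∀ y ∈ V, y ∉ S → D.D s y = (logGen S x y).smulRight (g y)) → R (s x) = g x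

/-- `D (W) ⊆ W ⊗ Ω¹(log S)`. -/
def LogConnection.Preserves {S : Finset X} (D : LogConnection n E S)
    (W : ∀ x, Submodule ℂ (E x)) : Prop :=
  ∀ (U : Set X) (s : ∀ x, E x), IsOpen U → IsHolSection n U s → (∀ y ∈ U, s y ∈ W y) →
    IsLogForm n S W U (D.D s)

/-- `D` is irreducible: the only holomorphic subbundles of `E` preserved by `D` are `0` and `E`. -/
def LogConnection.Irreducible {S : Finset X} (D : LogConnection n E S) : Prop :=
  ∀ W : ∀ x, Submodule ℂ (E x), IsHolSubbundle n W → D.Preserves W →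
    (∀ x, W x = ⊥) ∨ (∀ x, W x = ⊤)

variable (n E) [VectorBundle ℂ (Fin n → ℂ) E]

variable {E} in
/-- The coordinate at `y` of a section `σ` of the determinant line bundle `⋀ⁿ E` in the
trivialization of `⋀ⁿ E` induced by the preferred local trivialization of `E` around `x`. -/
def detCoord (σ : ∀ y, ⋀[ℂ]^n (E y)) (x y : X) : ℂ :=
  exteriorPower.alternatingMapLinearEquiv (Matrix.detRowAlternating (n := Fin n) (R := ℂ))
    (exteriorPower.map n ((trivializationAt (Fin n → ℂ) E x).linearMapAt ℂ y) (σ y))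

variable {E} in
/-- The coordinate of `σ` around `x`, as a function of the preferred coordinate of `X`
around `x`. -/
def detCoordInChart (σ : ∀ y, ⋀[ℂ]^n (E y)) (x : X) : ℂ → ℂ :=
  fun z => detCoord n σ x ((chartAt ℂ x).symm z)

variable {E} in
/-- The order at `x` of a meromorphic section of `⋀ⁿ E` (`⊤` if it vanishes near `x`). -/
def detOrder (σ : ∀ y, ⋀[ℂ]^n (E y)) (x : X) : WithTop ℤ :=
  meromorphicOrderAt (detCoordInChart n σ x) (chartAt ℂ x x)

variable {E} in
/-- `σ` is a nonzero meromorphic section of `⋀ⁿ E` (not identically zero near any point). Its values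
at the poles are irrelevant. -/
def IsMeroDetSection (σ : ∀ y, ⋀[ℂ]^n (E y)) : Prop :=
  ∀ x, MeromorphicAt (detCoordInChart n σ x) (chartAt ℂ x x) ∧ detOrder n σ x ≠ ⊤

/-- The degree of the divisor of some nonzero meromorphic section of `⋀ⁿ E` is `d`. -/
def IsDegree (d : ℤ) : Prop :=
  ∃ σ : ∀ y, ⋀[ℂ]^n (E y), IsMeroDetSection n σ ∧ d = ∑ᶠ x, (detOrder n σ x).untop₀

open Classical in
/-- The degree of a holomorphic vector bundle `E` of rank `n` on a compact Riemann surface: the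
degree of the determinant line bundle `⋀ⁿ E`, that is, of the divisor of any nonzero meromorphic
section of it. -/
def degree : ℤ :=
  if h : ∃ d, IsDegree n E d then h.choose else 0

end LogConn

end

/-! Let `W` be a preserved subbundle of rank r. A scalar residue acts on every subspace by the same
scalar, so the connection induced on det W has residue r λ_j at x_j. For a logarithmic connection on
a line bundle over a compact Riemann surface, the sum of the residues is minus the degree, in
particular an integer. Hence r Σ λ_j = k with k an integer, while W = E gives d = -n Σ λ_j.
Eliminating the λ_j leaves r d = -n k, so n divides r by coprimality, and 0 ≤ r ≤ n forces r = 0 or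
r = n.

The analytic input is the residue theorem `IsClosedForm.sum_circInt_eq_zero`: a closed smooth form
on the complement of a finite set T has circle integrals around the points of T adding up to zero.
It follows from Stokes' theorem in the plane and a partition of unity whose members are radial near
T. It is applied to θ = Dσ / σ, where σ is a section of the line bundle without zeros off T. In a
frame, θ is df / f plus the connection form, so a circle integral is 2πi times a winding number plus
a residue (`IsLogLineData.sum_residue`).

Two sections are used. For det W only integrality is needed, and no meromorphic section has to
exist: a generic combination of truncated local frames is a smooth section with isolated zeros, by a
Sard argument (`ae_injective_fderiv`), and winding numbers are integers
(`IsLogLineData.exists_sum_eq_intCast`). For det E the section is the meromorphic one that computes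
the degree, and the winding numbers are its orders (`IsLogLineData.finsum_order_add_sum`). Passing
from a bundle to its determinant is Jacobi's formula combined with the gauge transformation law of
connection matrices. -/

open scoped Manifold ContDiff Topology Bundle
open Bundle

noncomputable section

namespace LogConn

open MeasureTheory Complex Set Filter

/-! ### Forms, Stokes' theorem and winding numbers in the plane. -/

/-- The coefficient of `dx ∧ dy` in the wedge product of two real-linear forms on `ℂ`. -/
def wedge (α β : ℂ →L[ℝ] ℂ) : ℂ := α 1 * β I - α I * β 1

theorem wedge_zero_left (β : ℂ →L[ℝ] ℂ) : wedge 0 β = 0 := by simp [wedge]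

theorem wedge_sum_left {ι : Type*} (s : Finset ι) (α : ι → ℂ →L[ℝ] ℂ) (β : ℂ →L[ℝ] ℂ) :
    wedge (∑ i ∈ s, α i) β = ∑ i ∈ s, wedge (α i) β := by
  simp [wedge, Finset.sum_mul, Finset.sum_sub_distrib]

/-- Multiplication by a complex number, as a real-linear map. -/
def mulReal (a : ℂ) : ℂ →L[ℝ] ℂ := a • ContinuousLinearMap.id ℝ ℂ

@[simp] theorem mulReal_apply (a v : ℂ) : mulReal a v = a * v := by simp [mulReal]

theorem real_linear_apply (α : ℂ →L[ℝ] ℂ) (v : ℂ) : α v = v.re * α 1 + v.im * α I := by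
  conv_lhs => rw [show v = v.re • (1 : ℂ) + v.im • I by
    apply Complex.ext <;> simp]
  rw [map_add, map_smul, map_smul]
  simp

/-- Multiplication by `a` has real determinant |a|², the Jacobian of a holomorphic coordinate change
with derivative `a`. This makes integrals of 2-forms independent of the chart. -/
theorem wedge_comp_mulReal (α β : ℂ →L[ℝ] ℂ) (a : ℂ) :
    wedge (α.comp (mulReal a)) (β.comp (mulReal a)) = (normSq a : ℂ) * wedge α β := by
  simp only [wedge, ContinuousLinearMap.comp_apply, mulReal_apply]
  rw [real_linear_apply α (a * 1), real_linear_apply α (a * I), real_linear_apply β (a * 1),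
    real_linear_apply β (a * I)]
  simp [normSq_apply]
  ring

theorem det_mulReal (a : ℂ) : (mulReal a).det = normSq a := by
  rw [ContinuousLinearMap.det, ← LinearMap.det_toMatrix Complex.basisOneI, Matrix.det_fin_two]
  simp [LinearMap.toMatrix_apply, Complex.basisOneI, normSq_apply]

theorem integral_fderiv_apply_eq_zero {P : ℂ → ℂ} (hP : ContDiff ℝ 1 P)
    (hc : HasCompactSupport P) (v : ℂ) : ∫ z, fderiv ℝ P z v = 0 := by
  have hcont : Continuous fun z => fderiv ℝ P z v :=
    (hP.continuous_fderiv (by norm_num)).clm_apply continuous_const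
  have hcs : HasCompactSupport fun z => fderiv ℝ P z v :=
    hc.fderiv_apply (𝕜 := ℝ) v
  have h := integral_bilinear_fderiv_right_eq_neg_left_of_integrable (μ := (volume : Measure ℂ))
    (B := ContinuousLinearMap.mul ℝ ℂ) (f := fun _ => 1) (g := P) (v := v) (by simp)
    (by simpa using hcont.integrable_of_hasCompactSupport hcs)
    (by simpa using hP.continuous.integrable_of_hasCompactSupport hc) (by fun_prop)
    (fun z _ => hP.differentiable (by norm_num) z)
  simpa using h

/-- Stokes' theorem for a closed form with a compactly supported factor. -/
theorem integral_wedge_fderiv_eq_zero {V : Set ℂ} (hV : IsOpen V) {u : ℂ → ℂ}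
    (hu : ContDiff ℝ 1 u) (hc : HasCompactSupport u) (hs : tsupport u ⊆ V)
    {θ : ℂ → ℂ →L[ℝ] ℂ} (hθ : ContDiffOn ℝ 1 θ V)
    (hcl : ∀ z ∈ V, fderiv ℝ θ z 1 I = fderiv ℝ θ z I 1) :
    ∫ z, wedge (fderiv ℝ u z) (θ z) = 0 := by
  -- The form `θ` is controlled only on `V`, but the product with `u` vanishes near every point
  -- outside the support of `u`.
  have key (v : ℂ) : ContDiff ℝ 1 (fun z => u z * θ z v) := by
    rw [contDiff_iff_contDiffAt]
    intro z
    by_cases hz : z ∈ tsupport u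
    · exact hu.contDiffAt.mul
        ((hθ.contDiffAt (hV.mem_nhds (hs hz))).clm_apply contDiffAt_const)
    · refine (contDiffAt_const (c := (0 : ℂ))).congr_of_eventuallyEq ?_
      filter_upwards [notMem_tsupport_iff_eventuallyEq.1 hz] with w hw
      simp [hw]
  have hcs (v : ℂ) : HasCompactSupport (fun z => u z * θ z v) := hc.mul_right
  -- This is d(uθ) = du ∧ θ: the terms containing derivatives of `θ` cancel by closedness.
  have hpt (z : ℂ) : wedge (fderiv ℝ u z) (θ z) =
      fderiv ℝ (fun z => u z * θ z I) z 1 - fderiv ℝ (fun z => u z * θ z 1) z I := by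
    by_cases hz : z ∈ tsupport u
    · have hd := (hθ.contDiffAt (hV.mem_nhds (hs hz))).differentiableAt (by norm_num)
      have hud := hu.contDiffAt (x := z).differentiableAt (by norm_num)
      have h1 (v : ℂ) : HasFDerivAt (fun z => u z * θ z v) (u z • ((fderiv ℝ θ z).flip v) +
          (θ z v) • fderiv ℝ u z) z := by
        have := hud.hasFDerivAt.mul (hd.hasFDerivAt.clm_apply (hasFDerivAt_const v z))
        convert! this using 2
        ext w; simp
      rw [(h1 I).fderiv, (h1 1).fderiv]
      simp only [wedge, add_apply, smul_apply,
        ContinuousLinearMap.flip_apply, smul_eq_mul, hcl z (hs hz)]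
      ring
    · have h0 := notMem_tsupport_iff_eventuallyEq.1 hz
      have h1 (v : ℂ) : (fun z => u z * θ z v) =ᶠ[𝓝 z] fun _ => 0 := by
        filter_upwards [h0] with w hw
        simp [hw]
      have h0' : u =ᶠ[𝓝 z] fun _ => 0 := h0
      rw [(h1 I).fderiv_eq, (h1 1).fderiv_eq, h0'.fderiv_eq]
      simp [wedge]
  simp_rw [hpt]
  rw [integral_sub, integral_fderiv_apply_eq_zero (key I) (hcs I),
    integral_fderiv_apply_eq_zero (key 1) (hcs 1), sub_zero]
  · exact (((key I).continuous_fderiv (by norm_num)).clm_apply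
      continuous_const).integrable_of_hasCompactSupport ((hcs I).fderiv_apply (𝕜 := ℝ) 1)
  · exact (((key 1).continuous_fderiv (by norm_num)).clm_apply
      continuous_const).integrable_of_hasCompactSupport ((hcs 1).fderiv_apply (𝕜 := ℝ) I)

/-- The product of γ with exp(-∫ γ'/γ) has zero derivative. Since γ takes the same value at both
ends, the exponential of the full integral is 1. -/
theorem exists_int_integral_logDeriv {a b : ℝ} {γ γ' : ℝ → ℂ} (h : ∀ t, HasDerivAt γ (γ' t) t)
    (hc : Continuous γ') (h0 : ∀ t, γ t ≠ 0) (hab : γ a = γ b) :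
    ∃ k : ℤ, ∫ t in a..b, γ' t / γ t = k * (2 * Real.pi * I) := by
  have hγ : Continuous γ := continuous_iff_continuousAt.2 fun t => (h t).continuousAt
  have hq : Continuous fun t => γ' t / γ t := hc.div hγ h0
  have hF (t : ℝ) : HasDerivAt (fun t => ∫ s in a..t, γ' s / γ s) (γ' t / γ t) t :=
    hq.integral_hasStrictDerivAt a t |>.hasDerivAt
  have hG (t : ℝ) : HasDerivAt (fun t => γ t * cexp (-∫ s in a..t, γ' s / γ s)) 0 t := by
    have := (h t).mul (hF t).neg.cexp
    convert! this using 1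
    field_simp [h0 t]
    ring
  have hconst := is_const_of_deriv_eq_zero (fun t => (hG t).differentiableAt)
    (fun t => (hG t).deriv) b a
  simp only [intervalIntegral.integral_same, neg_zero, Complex.exp_zero, mul_one, hab] at hconst
  have h1 : cexp (-∫ s in a..b, γ' s / γ s) = 1 := by
    simpa [h0 b] using hconst
  obtain ⟨k, hk⟩ := Complex.exp_eq_one_iff.1 h1
  exact ⟨-k, by rw [← neg_neg (∫ s in a..b, γ' s / γ s), hk]; push_cast; ring⟩

/-- A continuous integer-valued function on an interval is constant. This makes winding numbers
independent of the radius. -/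
theorem exists_forall_eq_intCast {R : ℝ} {W : ℝ → ℂ} (hW : ContinuousOn W (Ioo 0 R))
    (hk : ∀ r ∈ Ioo 0 R, ∃ k : ℤ, W r = k * (2 * Real.pi * I)) :
    ∃ k : ℤ, ∀ r ∈ Ioo 0 R, W r = k * (2 * Real.pi * I) := by
  choose! n hn using hk
  have hpi : (2 * Real.pi * I : ℂ) ≠ 0 := by simp [Real.pi_ne_zero]
  have hcont : Continuous fun r : Ioo 0 R => n r := by
    rw [Int.isClosedEmbedding_coe_real.isEmbedding.continuous_iff]
    have h1 : Continuous fun r : Ioo 0 R => (W r / (2 * Real.pi * I)).re :=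
      Complex.continuous_re.comp ((continuousOn_iff_continuous_domRestrict.1 hW).div_const _)
    refine h1.congr fun r => ?_
    rw [hn r r.2, mul_div_cancel_right₀ _ hpi]
    simp
  by_cases hR : 0 < R
  · have : PreconnectedSpace (Ioo 0 R) := Subtype.preconnectedSpace isPreconnected_Ioo
    refine ⟨n (R / 2), fun r hr => ?_⟩
    rw [hn r hr]
    have := PreconnectedSpace.constant (inferInstanceAs (PreconnectedSpace (Ioo 0 R))) hcont
      (x := ⟨r, hr⟩) (y := ⟨R / 2, by constructor <;> linarith⟩)
    simp only at this
    rw [this]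
  · exact ⟨0, fun r hr => absurd (hr.1.trans hr.2) hR⟩

/-- The punctured disc. -/
def pball (p : ℂ) (R : ℝ) : Set ℂ := Metric.ball p R \ {p}

theorem isOpen_pball (p : ℂ) (R : ℝ) : IsOpen (pball p R) :=
  Metric.isOpen_ball.sdiff isClosed_singleton

/-- The standard parametrization of circles. -/
def circ (p : ℂ) (r t : ℝ) : ℂ := p + r * cexp (t * I)

theorem circ_mem_pball {p : ℂ} {R r : ℝ} (hr : r ∈ Ioo 0 R) (t : ℝ) : circ p r t ∈ pball p R := by
  have h1 : ‖(r : ℂ) * cexp (t * I)‖ = r := by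
    simp [Complex.norm_exp_ofReal_mul_I, abs_of_pos hr.1]
  refine ⟨by simpa [circ, abs_of_pos hr.1] using hr.2, fun h => ?_⟩
  have : (r : ℂ) * cexp (t * I) = 0 := by simpa [circ] using h
  rw [this, norm_zero] at h1
  exact hr.1.ne h1

theorem hasDerivAt_circ (p : ℂ) (r t : ℝ) : HasDerivAt (circ p r) (I * r * cexp (t * I)) t := by
  have h1 : HasDerivAt (fun t : ℝ => (t : ℂ) * I) I t := by
    simpa using (Complex.ofRealCLM.hasDerivAt (x := t)).mul_const I
  have := ((h1.cexp).const_mul (r : ℂ)).const_add p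
  convert! this using 1
  ring

theorem continuous_circ (p : ℂ) : Continuous fun x : ℝ × ℝ => circ p x.1 x.2 := by
  unfold circ; fun_prop

/-- The integral of a real-linear form over a circle. -/
def circInt (θ : ℂ → ℂ →L[ℝ] ℂ) (p : ℂ) (r : ℝ) : ℂ :=
  ∫ t in (-Real.pi)..Real.pi, θ (circ p r t) (I * r * cexp (t * I))

theorem continuousOn_circ_form {θ : ℂ → ℂ →L[ℝ] ℂ} {p : ℂ} {R : ℝ}
    (hθ : ContinuousOn θ (pball p R)) :
    ContinuousOn (fun x : ℝ × ℝ => θ (circ p x.1 x.2) (I * x.1 * cexp (x.2 * I)))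
      (Ioo 0 R ×ˢ univ) := by
  refine ContinuousOn.clm_apply (hθ.comp (continuous_circ p).continuousOn ?_)
    (by fun_prop)
  rintro ⟨r, t⟩ ⟨hr, -⟩
  exact circ_mem_pball hr t

theorem continuousOn_circInt {θ : ℂ → ℂ →L[ℝ] ℂ} {p : ℂ} {R : ℝ}
    (hθ : ContinuousOn θ (pball p R)) : ContinuousOn (circInt θ p) (Ioo 0 R) := by
  rw [continuousOn_iff_continuous_domRestrict]
  refine intervalIntegral.continuous_parametric_intervalIntegral_of_continuous'
    (f := fun (r : Ioo 0 R) (t : ℝ) => θ (circ p r t) (I * r * cexp (t * I))) ?_ _ _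
  exact (continuousOn_circ_form hθ).comp_continuous
    (f := fun x : Ioo 0 R × ℝ => ((x.1 : ℝ), x.2)) (by fun_prop) (fun x => ⟨x.1.2, mem_univ _⟩)

/-- The logarithmic differential of a complex function of a complex variable. -/
def dlog (f : ℂ → ℂ) (z : ℂ) : ℂ →L[ℝ] ℂ := (f z)⁻¹ • fderiv ℝ f z

/-- The integral is 2πi times the winding number of the image of the circle under `f`. Only real
differentiability of `f` is needed, so the lemma applies to non-holomorphic sections. -/
theorem exists_int_circInt_dlog {f : ℂ → ℂ} {p : ℂ} {R : ℝ} (hf : ContDiffOn ℝ 1 f (pball p R))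
    (h0 : ∀ z ∈ pball p R, f z ≠ 0) :
    ∃ k : ℤ, ∀ r ∈ Ioo 0 R, circInt (dlog f) p r = k * (2 * Real.pi * I) := by
  have hd : ContinuousOn (fderiv ℝ f) (pball p R) :=
    hf.continuousOn_fderiv_of_isOpen (isOpen_pball p R) (by norm_num)
  have hθ : ContinuousOn (dlog f) (pball p R) := (hf.continuousOn.inv₀ h0).smul hd
  refine exists_forall_eq_intCast (continuousOn_circInt hθ) fun r hr => ?_
  have hder (t : ℝ) : HasDerivAt (fun t => f (circ p r t))
      (fderiv ℝ f (circ p r t) (I * r * cexp (t * I))) t := by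
    have h1 := (hf.differentiableOn (by norm_num)).differentiableAt
      ((isOpen_pball p R).mem_nhds (circ_mem_pball hr t))
    exact h1.hasFDerivAt.comp_hasDerivAt t (hasDerivAt_circ p r t)
  have hcont : Continuous fun t : ℝ => fderiv ℝ f (circ p r t) (I * r * cexp (t * I)) :=
    (continuousOn_circ_form hd).comp_continuous
      (f := fun t : ℝ => (r, t)) (by fun_prop) (fun x => ⟨hr, mem_univ _⟩)
  obtain ⟨k, hk⟩ := exists_int_integral_logDeriv (a := -Real.pi) (b := Real.pi) hder hcont
    (fun t => h0 _ (circ_mem_pball hr t)) (by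
      have : cexp (((-Real.pi : ℝ) : ℂ) * I) = cexp ((Real.pi : ℝ) * I) := by
        rw [Complex.exp_pi_mul_I, Complex.ofReal_neg, neg_mul, Complex.exp_neg,
          Complex.exp_pi_mul_I]; norm_num
      simp only [circ, this])
  refine ⟨k, ?_⟩
  rw [← hk]
  simp only [circInt, dlog, smul_apply, smul_eq_mul, div_eq_inv_mul]

theorem hasFDerivAt_comp_norm {b : ℝ → ℝ} {b' : ℝ} {p z : ℂ} (hz : z ≠ p)
    (hb : HasDerivAt b b' ‖z - p‖) :
    HasFDerivAt (fun z : ℂ => (b ‖z - p‖ : ℂ))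
      (Complex.ofRealCLM.comp ((b' * ‖z - p‖⁻¹) • innerSL ℝ (z - p))) z := by
  have h1 : HasFDerivAt (fun z : ℂ => ‖z - p‖ ^ 2) ((2 : ℝ) • innerSL ℝ (z - p)) z := by
    have := ((hasFDerivAt_id z).sub_const p).norm_sq
    simpa [two_smul] using! this
  have hpos : ‖z - p‖ ≠ 0 := by simpa [sub_eq_zero] using hz
  have h2 := h1.sqrt (by positivity)
  simp only [Real.sqrt_sq (norm_nonneg _)] at h2
  have h3 := hb.comp_hasFDerivAt z h2
  have h4 := Complex.ofRealCLM.hasFDerivAt.comp z h3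
  convert! h4 using 2
  rw [smul_smul, smul_smul]
  congr 1
  field_simp

/-- Stokes' theorem in a punctured disc for a radial cutoff function. -/
theorem integral_wedge_radial {b : ℝ → ℝ} (hb : ContDiff ℝ 1 b) {a R' R : ℝ} (ha : 0 < a)
    (hR : R' < R) (hb1 : ∀ r ≤ a, b r = 1) (hb0 : ∀ r, R' ≤ r → b r = 0)
    {θ : ℂ → ℂ →L[ℝ] ℂ} {p w : ℂ} (hθ : ContinuousOn θ (pball p R))
    (hw : ∀ r ∈ Ioo 0 R, circInt θ p r = w) :
    ∫ z, wedge (fderiv ℝ (fun z : ℂ => (b ‖z - p‖ : ℂ)) z) (θ z) = -w := by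
  have hb' : ∀ r, HasDerivAt b (deriv b r) r := fun r =>
    (hb.differentiable (by norm_num) r).hasDerivAt
  have hbc : Continuous (deriv b) := hb.continuous_deriv (by norm_num)
  have hz1 : ∀ r < a, deriv b r = 0 := fun r hr => by
    have : b =ᶠ[𝓝 r] fun _ => 1 := by
      filter_upwards [Iio_mem_nhds hr] with s hs using hb1 s (le_of_lt hs)
    rw [this.deriv_eq, deriv_const]
  have hz0 : ∀ r, R' < r → deriv b r = 0 := fun r hr => by
    have : b =ᶠ[𝓝 r] fun _ => 0 := by
      filter_upwards [Ioi_mem_nhds hr] with s hs using hb0 s (le_of_lt hs)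
    rw [this.deriv_eq, deriv_const]
  set G : ℝ × ℝ → ℂ := fun x => ((deriv b x.1 : ℝ) : ℂ) *
    θ (circ p x.1 x.2) (I * x.1 * cexp (x.2 * I)) with hG
  -- In polar coordinates the cutoff has differential b'(r) dr. After multiplication by the Jacobian
  -- r, only the value of `θ` on the angular velocity of the circle survives.
  have hpt : ∀ x ∈ _root_.polarCoord.target,
      x.1 • wedge (fderiv ℝ (fun z : ℂ => (b ‖z - p‖ : ℂ)) (p + Complex.polarCoord.symm x))
        (θ (p + Complex.polarCoord.symm x)) = G x := by
    rintro ⟨r, t⟩ hx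
    have hr : 0 < r := by
      have := hx; rw [_root_.polarCoord_target] at this; exact this.1
    have hpc : p + Complex.polarCoord.symm (r, t) = circ p r t := by
      rw [Complex.polarCoord_symm_apply, circ, Complex.exp_mul_I]; push_cast; ring
    have hsub : circ p r t - p = r * cexp (t * I) := by simp [circ]
    have hnorm : ‖circ p r t - p‖ = r := by
      rw [hsub]; simp [Complex.norm_exp_ofReal_mul_I, abs_of_pos hr]
    have hne : circ p r t ≠ p := fun h => by
      rw [h, sub_self, norm_zero] at hnorm; exact hr.ne hnorm
    rw [hpc, (hasFDerivAt_comp_norm hne (b' := deriv b r) (by rw [hnorm]; exact hb' r)).fderiv]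
    rw [hnorm, hsub]
    simp only [hG, wedge]
    rw [real_linear_apply (θ (circ p r t)) (I * r * cexp (t * I))]
    have hre : (cexp (t * I)).re = Real.cos t := by
      rw [Complex.exp_mul_I]; simp [← Complex.ofReal_cos, ← Complex.ofReal_sin]
    have him : (cexp (t * I)).im = Real.sin t := by
      rw [Complex.exp_mul_I]; simp [← Complex.ofReal_cos, ← Complex.ofReal_sin]
    have hr' : (r : ℂ) ≠ 0 := by exact_mod_cast hr.ne'
    simp [Complex.inner, hre, him, -Complex.ofReal_cos, -Complex.ofReal_sin]
    field_simp
    ring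
  have hGc : ContinuousOn G (Ioo 0 R ×ˢ univ) :=
    (by fun_prop : Continuous fun x : ℝ × ℝ => ((deriv b x.1 : ℝ) : ℂ)).continuousOn.mul
      (continuousOn_circ_form hθ)
  -- Although `θ` may be singular at `p`, the factor b' vanishes off the compact interval [a, R'],
  -- which lies inside (0, R).
  have hGint : IntegrableOn G (Ioi 0 ×ˢ Ioo (-Real.pi) Real.pi) (volume.prod volume) := by
    have h1 : IntegrableOn G (Icc a R' ×ˢ Icc (-Real.pi) Real.pi) (volume.prod volume) :=
      ContinuousOn.integrableOn_compact (isCompact_Icc.prod isCompact_Icc)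
        (hGc.mono (prod_mono (fun r hr => ⟨ha.trans_le hr.1, hr.2.trans_lt hR⟩) (subset_univ _)))
    refine (h1.mono_set (prod_mono_right Ioo_subset_Icc_self)).of_forall_sdiff_eq_zero
      (measurableSet_Ioi.prod measurableSet_Ioo) ?_
    rintro ⟨r, t⟩ ⟨⟨hr, ht⟩, hn⟩
    have : deriv b r = 0 := by
      by_contra hne
      exact hn ⟨⟨not_lt.1 fun h => hne (hz1 r h), not_lt.1 fun h => hne (hz0 r h)⟩, ht⟩
    simp [hG, this]
  calc ∫ z, wedge (fderiv ℝ (fun z : ℂ => (b ‖z - p‖ : ℂ)) z) (θ z)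
      = ∫ z, wedge (fderiv ℝ (fun z : ℂ => (b ‖z - p‖ : ℂ)) (p + z)) (θ (p + z)) :=
        (integral_add_left_eq_self
          (fun z => wedge (fderiv ℝ (fun z : ℂ => (b ‖z - p‖ : ℂ)) z) (θ z)) p).symm
    _ = ∫ x in _root_.polarCoord.target, G x := by
        rw [← Complex.integral_comp_polarCoord_symm]
        exact setIntegral_congr_fun (by
          rw [_root_.polarCoord_target]; exact measurableSet_Ioi.prod measurableSet_Ioo) hpt
    _ = ∫ r in Ioi (0 : ℝ), ∫ t in Ioo (-Real.pi) Real.pi, G (r, t) := by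
        rw [_root_.polarCoord_target]
        exact setIntegral_prod G hGint
    _ = ∫ r in Ioi (0 : ℝ), ((deriv b r : ℝ) : ℂ) * w := by
        refine setIntegral_congr_fun measurableSet_Ioi fun r hr => ?_
        simp only [hG]
        rw [integral_const_mul]
        by_cases hrR : r < R
        · rw [← hw r ⟨hr, hrR⟩, circInt, intervalIntegral.integral_of_le (by linarith [Real.pi_pos]),
            integral_Ioc_eq_integral_Ioo]
        · rw [hz0 r (by linarith)]; simp
    _ = -w := by
        rw [integral_mul_const, integral_complex_ofReal]
        -- The cutoff falls from 1 to 0, which produces the sign in -w.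
        have : ∫ r in Ioi (0 : ℝ), deriv b r = 0 - b 0 := by
          refine integral_Ioi_of_hasDerivAt_of_tendsto' (fun r _ => hb' r) ?_ ?_
          · have h1 : IntegrableOn (deriv b) (Icc a R') :=
              hbc.continuousOn.integrableOn_compact isCompact_Icc
            refine (h1.mono_set (s := Icc a R') le_rfl).of_forall_sdiff_eq_zero
              measurableSet_Ioi ?_
            rintro r ⟨-, hn⟩
            by_contra hne
            exact hn ⟨not_lt.1 fun h => hne (hz1 r h), not_lt.1 fun h => hne (hz0 r h)⟩
          · refine tendsto_const_nhds.congr' ?_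
            filter_upwards [eventually_ge_atTop R'] with r hr using (hb0 r hr).symm
        rw [this, hb1 0 ha.le]
        simp

/-! ### Closed forms on a Riemann surface and their pairing with a partition of unity. -/

section Core

variable {X : Type*} [TopologicalSpace X] [ChartedSpace ℂ X]

/-- The coordinate change from the chart around `x` to the chart around `y`. -/
def trans (x y : X) : ℂ → ℂ := chartAt ℂ y ∘ (chartAt ℂ x).symm

theorem trans_apply {x y q : X} (hx : q ∈ (chartAt ℂ x).source) :
    trans x y (chartAt ℂ x q) = chartAt ℂ y q := by
  simp [trans, (chartAt ℂ x).left_inv hx]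

theorem differentiableAt_trans [IsManifold 𝓘(ℂ, ℂ) ω X] {x y q : X}
    (hx : q ∈ (chartAt ℂ x).source) (hy : q ∈ (chartAt ℂ y).source) :
    DifferentiableAt ℂ (trans x y) (chartAt ℂ x q) := by
  have h := contDiffWithinAt_ext_coord_change (I := 𝓘(ℂ, ℂ)) (n := ω) y x
    (y := chartAt ℂ x q) (by simp [hx, hy])
  have h2 := h.differentiableWithinAt (by simp)
  simpa [trans, differentiableWithinAt_univ] using! h2

theorem eventually_symm_mem {A : Set X} (hA : IsOpen A) {x q : X}
    (hx : q ∈ (chartAt ℂ x).source) (hq : q ∈ A) :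
    ∀ᶠ z in 𝓝 (chartAt ℂ x q), z ∈ (chartAt ℂ x).target ∧ (chartAt ℂ x).symm z ∈ A := by
  have h1 : (chartAt ℂ x).target ∈ 𝓝 (chartAt ℂ x q) :=
    (chartAt ℂ x).open_target.mem_nhds ((chartAt ℂ x).map_source hx)
  refine Filter.Eventually.and h1 ?_
  have h2 := (chartAt ℂ x).continuousAt_symm ((chartAt ℂ x).map_source hx)
  refine h2 (hA.mem_nhds ?_)
  rwa [(chartAt ℂ x).left_inv hx]

theorem comp_symm_eventuallyEq {α : Type*} (η : X → α) {x y q : X}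
    (hx : q ∈ (chartAt ℂ x).source) (hy : q ∈ (chartAt ℂ y).source) :
    η ∘ (chartAt ℂ x).symm =ᶠ[𝓝 (chartAt ℂ x q)] (η ∘ (chartAt ℂ y).symm) ∘ trans x y := by
  filter_upwards [eventually_symm_mem (chartAt ℂ y).open_source hx hy] with z hz
  simp [trans, (chartAt ℂ y).left_inv hz.2]

theorem comp_symm_eventuallyEq_of_eventuallyEq {α : Type*} {η η' : X → α} {x q : X}
    (hx : q ∈ (chartAt ℂ x).source) (h : η =ᶠ[𝓝 q] η') :
    η ∘ (chartAt ℂ x).symm =ᶠ[𝓝 (chartAt ℂ x q)] η' ∘ (chartAt ℂ x).symm := by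
  have h2 := (chartAt ℂ x).continuousAt_symm ((chartAt ℂ x).map_source hx)
  rw [ContinuousAt, (chartAt ℂ x).left_inv hx] at h2
  exact h2 h

theorem hasFDerivAt_mulReal {f : ℂ → ℂ} {z : ℂ} (h : DifferentiableAt ℂ f z) :
    HasFDerivAt f (mulReal (deriv f z)) z := by
  have := h.hasFDerivAt.restrictScalars ℝ
  convert! this using 1
  ext v
  simp [mul_comm]

/-- Smoothness, in the real sense, of a complex function on `X`. -/
def IsSmoothFun (η : X → ℂ) : Prop :=
  ∀ x, ContDiffOn ℝ ∞ (η ∘ (chartAt ℂ x).symm) (chartAt ℂ x).target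

theorem IsSmoothFun.contDiffAt {η : X → ℂ} (h : IsSmoothFun η) {x q : X}
    (hx : q ∈ (chartAt ℂ x).source) :
    ContDiffAt ℝ ∞ (η ∘ (chartAt ℂ x).symm) (chartAt ℂ x q) :=
  (h x).contDiffAt ((chartAt ℂ x).open_target.mem_nhds ((chartAt ℂ x).map_source hx))

theorem IsSmoothFun.differentiableAt {η : X → ℂ} (h : IsSmoothFun η) {x q : X}
    (hx : q ∈ (chartAt ℂ x).source) :
    DifferentiableAt ℝ (η ∘ (chartAt ℂ x).symm) (chartAt ℂ x q) :=
  (h.contDiffAt hx).differentiableAt (by simp)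

theorem fderiv_comp_symm [IsManifold 𝓘(ℂ, ℂ) ω X] {η : X → ℂ} {x y q : X}
    (hx : q ∈ (chartAt ℂ x).source) (hy : q ∈ (chartAt ℂ y).source)
    (hη : DifferentiableAt ℝ (η ∘ (chartAt ℂ y).symm) (chartAt ℂ y q)) :
    fderiv ℝ (η ∘ (chartAt ℂ x).symm) (chartAt ℂ x q) =
      (fderiv ℝ (η ∘ (chartAt ℂ y).symm) (chartAt ℂ y q)).comp
        (mulReal (deriv (trans x y) (chartAt ℂ x q))) := by
  rw [(comp_symm_eventuallyEq η hx hy).fderiv_eq]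
  have h1 := hasFDerivAt_mulReal (differentiableAt_trans hx hy)
  rw [← trans_apply (y := y) hx] at hη ⊢
  exact (hη.hasFDerivAt.comp _ h1).fderiv

/-- A closed real-linear complex `1`-form on the complement of `T`, given by its coefficients
`θ x` in the chart around `x`, on the neighbourhood `U x`. -/
structure IsClosedForm (T : Finset X) (U : X → Set X) (θ : X → ℂ → ℂ →L[ℝ] ℂ) : Prop where
  isOpen : ∀ x, IsOpen (U x)
  mem : ∀ x, x ∈ U x
  subset : ∀ x, U x ⊆ (chartAt ℂ x).source
  contDiffOn : ∀ x, ContDiffOn ℝ 1 (θ x) (chartAt ℂ x '' (U x \ T))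
  closed : ∀ x, ∀ z ∈ chartAt ℂ x '' (U x \ T), fderiv ℝ (θ x) z 1 I = fderiv ℝ (θ x) z I 1
  change : ∀ x y q, q ∈ U x → q ∈ U y → q ∉ T →
    θ x (chartAt ℂ x q) =
      (θ y (chartAt ℂ y q)).comp (mulReal (deriv (trans x y) (chartAt ℂ x q)))

/-- The coefficient of `u dη ∧ θ` in the chart around `x`. -/
def integrand (θ : X → ℂ → ℂ →L[ℝ] ℂ) (x : X) (u η : X → ℂ) (z : ℂ) : ℂ :=
  u ((chartAt ℂ x).symm z) * wedge (fderiv ℝ (η ∘ (chartAt ℂ x).symm) z) (θ x z)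

/-- The function `η` is locally constant near every point of `T`. -/
def LocConstNear (T : Finset X) (η : X → ℂ) : Prop := ∀ p ∈ T, ∃ c : ℂ, η =ᶠ[𝓝 p] fun _ => c

theorem isOpen_chart_image {x : X} {A : Set X} (hA : IsOpen A) (h : A ⊆ (chartAt ℂ x).source) :
    IsOpen (chartAt ℂ x '' A) :=
  (chartAt ℂ x).isOpen_image_of_subset_source hA h

theorem integrand_eq_zero_of_eventuallyEq (θ : X → ℂ → ℂ →L[ℝ] ℂ) {x q : X}
    (u : X → ℂ) {η : X → ℂ} {c : ℂ}
    (hx : q ∈ (chartAt ℂ x).source) (h : η =ᶠ[𝓝 q] fun _ => c) :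
    integrand θ x u η (chartAt ℂ x q) = 0 := by
  have h1 := comp_symm_eventuallyEq_of_eventuallyEq hx h
  have h2 : ((fun _ => c) ∘ (chartAt ℂ x).symm : ℂ → ℂ) = fun _ => c := rfl
  rw [integrand, h1.fderiv_eq, h2]
  simp [wedge]

theorem integrand_eq_zero (θ : X → ℂ → ℂ →L[ℝ] ℂ) {x q : X} {u η : X → ℂ}
    (hx : q ∈ (chartAt ℂ x).source) (h : q ∉ tsupport u ∩ tsupport η) :
    integrand θ x u η (chartAt ℂ x q) = 0 := by
  by_cases hu : q ∈ tsupport u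
  · have hη : q ∉ tsupport η := fun hη => h ⟨hu, hη⟩
    exact integrand_eq_zero_of_eventuallyEq θ u hx (notMem_tsupport_iff_eventuallyEq.1 hη)
  · rw [integrand, (chartAt ℂ x).left_inv hx, image_eq_zero_of_notMem_tsupport hu, zero_mul]

variable {T : Finset X} {U : X → Set X} {θ : X → ℂ → ℂ →L[ℝ] ℂ}

/-- The form may blow up at `T`, but dη vanishes near `T`. The integrand is therefore carried by a
compact set on which everything is continuous. -/
theorem IsClosedForm.integrableOn [T2Space X] [CompactSpace X] (h : IsClosedForm T U θ)
    {u η : X → ℂ} (hu : IsSmoothFun u) (hη : IsSmoothFun η) (hT : LocConstNear T η) {x : X}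
    (hs : tsupport u ∩ tsupport η ⊆ U x) :
    IntegrableOn (integrand θ x u η) (chartAt ℂ x '' U x) := by
  set N : Set X := interior {q | ∃ c : ℂ, η =ᶠ[𝓝 q] fun _ => c} with hN
  have hNT : ∀ p ∈ T, p ∈ N := fun p hp => by
    obtain ⟨c, hc⟩ := hT p hp
    rw [hN, mem_interior_iff_mem_nhds]
    filter_upwards [eventually_eventually_nhds.2 hc] with q hq using ⟨c, hq⟩
  set K : Set X := (tsupport u ∩ tsupport η) \ N with hK
  have hKc : IsCompact K :=
    (((isClosed_tsupport u).inter (isClosed_tsupport η)).sdiff isOpen_interior).isCompact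
  have hKU : K ⊆ U x \ T := fun q hq => ⟨hs hq.1, fun hqT => hq.2 (hNT q hqT)⟩
  have hKs : K ⊆ (chartAt ℂ x).source := fun q hq => h.subset x (hKU hq).1
  have hc' : IsCompact (chartAt ℂ x '' K) :=
    hKc.image_of_continuousOn ((chartAt ℂ x).continuousOn.mono hKs)
  have hKt : chartAt ℂ x '' K ⊆ (chartAt ℂ x).target := by
    rintro _ ⟨q, hq, rfl⟩
    exact (chartAt ℂ x).map_source (hKs hq)
  have hd : ContinuousOn (fderiv ℝ (η ∘ (chartAt ℂ x).symm)) (chartAt ℂ x).target :=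
    (hη x).continuousOn_fderiv_of_isOpen (chartAt ℂ x).open_target (by simp)
  have hθc : ContinuousOn (θ x) (chartAt ℂ x '' K) :=
    (h.contDiffOn x).continuousOn.mono (image_mono hKU)
  have hcont : ContinuousOn (integrand θ x u η) (chartAt ℂ x '' K) := by
    have h1 (v : ℂ) : ContinuousOn (fun z => fderiv ℝ (η ∘ (chartAt ℂ x).symm) z v)
        (chartAt ℂ x '' K) := (hd.mono hKt).clm_apply continuousOn_const
    have h2 (v : ℂ) : ContinuousOn (fun z => θ x z v) (chartAt ℂ x '' K) :=
      hθc.clm_apply continuousOn_const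
    exact ((hu x).continuousOn.mono hKt).mul (((h1 1).mul (h2 I)).sub ((h1 I).mul (h2 1)))
  have hint : IntegrableOn (integrand θ x u η) (chartAt ℂ x '' K) :=
    hcont.integrableOn_compact hc'
  refine hint.of_forall_sdiff_eq_zero
    (isOpen_chart_image (h.isOpen x) (h.subset x)).measurableSet ?_
  rintro _ ⟨⟨q, hq, rfl⟩, hn⟩
  by_cases hqN : q ∈ N
  · obtain ⟨c, hc⟩ := interior_subset hqN
    exact integrand_eq_zero_of_eventuallyEq θ u (h.subset x hq) hc
  · exact integrand_eq_zero θ (h.subset x hq) fun hmem => hn ⟨q, ⟨hmem, hqN⟩, rfl⟩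

theorem IsClosedForm.setIntegral_eq_inter (h : IsClosedForm T U θ)
    {u η : X → ℂ} {x y : X} (hs : tsupport u ∩ tsupport η ⊆ U y) :
    ∫ z in chartAt ℂ x '' U x, integrand θ x u η z =
      ∫ z in chartAt ℂ x '' (U x ∩ U y), integrand θ x u η z := by
  refine setIntegral_eq_of_subset_of_forall_sdiff_eq_zero
    (isOpen_chart_image (h.isOpen x) (h.subset x)).measurableSet (image_mono inter_subset_left) ?_
  rintro _ ⟨⟨q, hq, rfl⟩, hn⟩
  exact integrand_eq_zero θ (h.subset x hq) fun hmem => hn ⟨q, ⟨hq, hs hmem⟩, rfl⟩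

/-- Change of variables: the Jacobian of the coordinate change is the squared modulus of its
derivative, exactly the factor by which the wedge product transforms. At points of `T`, where the
forms are not related, both integrands vanish. -/
theorem IsClosedForm.setIntegral_integrand_eq [IsManifold 𝓘(ℂ, ℂ) ω X] (h : IsClosedForm T U θ)
    {u η : X → ℂ} (hη : IsSmoothFun η) (hT : LocConstNear T η) {x y : X}
    (hx : tsupport u ∩ tsupport η ⊆ U x) (hy : tsupport u ∩ tsupport η ⊆ U y) :
    ∫ z in chartAt ℂ x '' U x, integrand θ x u η z =
      ∫ z in chartAt ℂ y '' U y, integrand θ y u η z := by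
  rw [h.setIntegral_eq_inter hy, h.setIntegral_eq_inter hx, inter_comm (U y) (U x)]
  have hsx : U x ∩ U y ⊆ (chartAt ℂ x).source := inter_subset_left.trans (h.subset x)
  have hsy : U x ∩ U y ⊆ (chartAt ℂ y).source := inter_subset_right.trans (h.subset y)
  have himg : chartAt ℂ y '' (U x ∩ U y) = trans x y '' (chartAt ℂ x '' (U x ∩ U y)) := by
    rw [image_image]
    exact image_congr fun q hq => (trans_apply (hsx hq)).symm
  have hm : MeasurableSet (chartAt ℂ x '' (U x ∩ U y)) :=
    (isOpen_chart_image ((h.isOpen x).inter (h.isOpen y)) hsx).measurableSet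
  have hder : ∀ z ∈ chartAt ℂ x '' (U x ∩ U y), HasFDerivWithinAt (trans x y)
      (mulReal (deriv (trans x y) z)) (chartAt ℂ x '' (U x ∩ U y)) z := by
    rintro _ ⟨q, hq, rfl⟩
    exact (hasFDerivAt_mulReal (differentiableAt_trans (hsx hq) (hsy hq))).hasFDerivWithinAt
  have hinj : InjOn (trans x y) (chartAt ℂ x '' (U x ∩ U y)) := by
    rintro _ ⟨q, hq, rfl⟩ _ ⟨q', hq', rfl⟩ he
    rw [trans_apply (hsx hq), trans_apply (hsx hq')] at he
    rw [(chartAt ℂ y).injOn (hsy hq) (hsy hq') he]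
  rw [himg, integral_image_eq_integral_abs_det_fderiv_smul volume hm hder hinj]
  refine setIntegral_congr_fun hm ?_
  rintro _ ⟨q, hq, rfl⟩
  simp only [trans_apply (hsx hq), det_mulReal, abs_of_nonneg (normSq_nonneg _)]
  by_cases hqT : q ∈ T
  · obtain ⟨c, hc⟩ := hT q hqT
    rw [integrand_eq_zero_of_eventuallyEq θ u (hsx hq) hc,
      integrand_eq_zero_of_eventuallyEq θ u (hsy hq) hc, smul_zero]
  · rw [integrand, integrand, h.change x y q hq.1 hq.2 hqT,
      fderiv_comp_symm (hsx hq) (hsy hq) (hη.differentiableAt (hsy hq)), wedge_comp_mulReal,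
      (chartAt ℂ x).left_inv (hsx hq), (chartAt ℂ y).left_inv (hsy hq), real_smul]
    ring

/-- For a partition of unity subordinate to coordinate neighbourhoods, the integrals of the
differentials of its members against a closed form add up to zero. -/
theorem IsClosedForm.sum_integral_eq_zero [T2Space X] [CompactSpace X] [IsManifold 𝓘(ℂ, ℂ) ω X]
    (h : IsClosedForm T U θ) {ι : Type*} [Fintype ι] (x : ι → X) (η : ι → X → ℂ)
    (hη : ∀ i, IsSmoothFun (η i)) (hs : ∀ i, tsupport (η i) ⊆ U (x i))
    (hT : ∀ i, LocConstNear T (η i)) (h1 : ∀ q, ∑ i, η i q = 1) :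
    ∑ i, ∫ z in chartAt ℂ (x i) '' U (x i),
      wedge (fderiv ℝ (η i ∘ (chartAt ℂ (x i)).symm) z) (θ (x i) z) = 0 := by
  -- Inserting 1 = Σ η_j turns the sum into a double sum of integrals of η_j dη_i ∧ θ. Each of these
  -- can be moved to the chart of j, where the sum over i contains Σ dη_i = d1 = 0.
  have hA (i : ι) : ∫ z in chartAt ℂ (x i) '' U (x i),
      wedge (fderiv ℝ (η i ∘ (chartAt ℂ (x i)).symm) z) (θ (x i) z) =
      ∑ j, ∫ z in chartAt ℂ (x i) '' U (x i), integrand θ (x i) (η j) (η i) z := by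
    rw [← integral_finsetSum _ fun j _ =>
      h.integrableOn (hη j) (hη i) (hT i) (inter_subset_right.trans (hs i))]
    refine integral_congr_ae (Eventually.of_forall fun z => ?_)
    simp only [integrand]
    rw [← Finset.sum_mul, h1, one_mul]
  have hB (i j : ι) : ∫ z in chartAt ℂ (x i) '' U (x i), integrand θ (x i) (η j) (η i) z =
      ∫ z in chartAt ℂ (x j) '' U (x j), integrand θ (x j) (η j) (η i) z :=
    h.setIntegral_integrand_eq (hη i) (hT i) (inter_subset_right.trans (hs i))
      (inter_subset_left.trans (hs j))
  rw [Finset.sum_congr rfl fun i _ => (hA i).trans (Finset.sum_congr rfl fun j _ => hB i j),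
    Finset.sum_comm]
  refine Finset.sum_eq_zero fun j _ => ?_
  rw [← integral_finsetSum _ fun i _ =>
      h.integrableOn (hη j) (hη i) (hT i) (inter_subset_left.trans (hs j))]
  refine (setIntegral_congr_fun (isOpen_chart_image (h.isOpen _) (h.subset _)).measurableSet
    (g := fun _ => 0) ?_).trans (by simp)
  rintro _ ⟨q, hq, rfl⟩
  have hsum : ∑ i, fderiv ℝ (η i ∘ (chartAt ℂ (x j)).symm) (chartAt ℂ (x j) q) = 0 := by
    rw [← fderiv_fun_sum fun i _ => (hη i).differentiableAt (h.subset _ hq)]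
    simp [h1]
  simp only [integrand]
  rw [← Finset.mul_sum, ← wedge_sum_left, hsum, wedge_zero_left, mul_zero]

end Core

/-! ### Radial cutoff functions and the residue theorem. -/

section Residue

variable {X : Type*} [TopologicalSpace X] [ChartedSpace ℂ X]

theorem contDiffAt_trans [IsManifold 𝓘(ℂ, ℂ) ω X] {x y q : X}
    (hx : q ∈ (chartAt ℂ x).source) (hy : q ∈ (chartAt ℂ y).source) :
    ContDiffAt ℝ ∞ (trans x y) (chartAt ℂ x q) := by
  have h := contDiffWithinAt_ext_coord_change (I := 𝓘(ℂ, ℂ)) (n := ω) y x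
    (y := chartAt ℂ x q) (by simp [hx, hy])
  have h2 : ContDiffAt ℂ ω (trans x y) (chartAt ℂ x q) := by
    simpa [trans, contDiffWithinAt_univ] using! h
  exact (h2.restrict_scalars ℝ).of_le (by simp)

/-- Partitions of unity exist only in the real smooth category, so the complex structure is weakened
to a real one on the same charts. -/
theorem isManifold_real [IsManifold 𝓘(ℂ, ℂ) ω X] : IsManifold 𝓘(ℝ, ℂ) ∞ X := by
  refine isManifold_of_contDiffOn 𝓘(ℝ, ℂ) ∞ X fun e e' he he' => ?_
  have h := (mem_groupoid_of_pregroupoid.1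
    (HasGroupoid.compatible (G := contDiffGroupoid ω 𝓘(ℂ, ℂ)) he he')).1
  have h : ContDiffOn ℂ ω (e.symm ≫ₕ e') (e.symm ≫ₕ e').source := by
    simpa [contDiffPregroupoid] using! h
  have h2 := (h.restrict_scalars ℝ).of_le (m := ∞) (by simp)
  simpa using! h2

theorem isSmoothFun_of_contMDiff [IsManifold 𝓘(ℝ, ℂ) ∞ X] {f : X → ℝ}
    (hf : ContMDiff 𝓘(ℝ, ℂ) 𝓘(ℝ, ℝ) ∞ f) : IsSmoothFun (fun q => (f q : ℂ)) := by
  intro x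
  have h1 : ContMDiffOn 𝓘(ℝ, ℂ) 𝓘(ℝ, ℝ) ∞ (f ∘ (chartAt ℂ x).symm) (chartAt ℂ x).target :=
    hf.comp_contMDiffOn (contMDiffOn_chart_symm (I := 𝓘(ℝ, ℂ)) (x := x))
  exact Complex.ofRealCLM.contDiff.comp_contDiffOn h1.contDiffOn

theorem exists_partitionOfUnity [T2Space X] [CompactSpace X] [IsManifold 𝓘(ℂ, ℂ) ω X]
    {U : X → Set X} (hU : ∀ x, IsOpen (U x)) (hm : ∀ x, x ∈ U x) :
    ∃ (F : Finset X) (ρ : X → X → ℂ), (∀ x, IsSmoothFun (ρ x)) ∧ (∀ x, tsupport (ρ x) ⊆ U x) ∧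
      ∀ q, ∑ x ∈ F, ρ x q = 1 := by
  have := isManifold_real (X := X)
  obtain ⟨f, hf⟩ := SmoothPartitionOfUnity.exists_isSubordinate 𝓘(ℝ, ℂ) (s := (univ : Set X))
    isClosed_univ U hU (fun x _ => mem_iUnion.2 ⟨x, hm x⟩)
  have hfin : {i | (Function.support (f i)).Nonempty}.Finite :=
    f.locallyFinite.finite_nonempty_of_compact
  refine ⟨hfin.toFinset, fun x q => (f x q : ℂ), fun x => isSmoothFun_of_contMDiff (f x).contMDiff,
    fun x => ?_, fun q => ?_⟩
  · refine subset_trans (closure_mono fun q hq => ?_) (hf x)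
    simpa using hq
  · have h1 := f.sum_eq_one (mem_univ q)
    rw [finsum_eq_sum_of_support_subset (s := hfin.toFinset) _ fun i hi => by
      rw [Finite.coe_toFinset]; exact ⟨q, hi⟩] at h1
    simp only
    exact_mod_cast h1

theorem IsSmoothFun.mul {f g : X → ℂ} (hf : IsSmoothFun f) (hg : IsSmoothFun g) :
    IsSmoothFun fun q => f q * g q := fun x => (hf x).mul (hg x)

theorem isSmoothFun_one_sub_sum {ι : Type*} (s : Finset ι) {f : ι → X → ℂ}
    (hf : ∀ i ∈ s, IsSmoothFun (f i)) : IsSmoothFun fun q => 1 - ∑ i ∈ s, f i q :=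
  fun x => contDiffOn_const.sub (ContDiffOn.sum fun i hi => hf i hi x)

/-- A smooth cutoff function of a real variable. -/
def cutoff (R r : ℝ) : ℝ := Real.smoothTransition ((2 * R / 3 - r) / (R / 3))

theorem cutoff_eq_one {R r : ℝ} (hR : 0 < R) (h : r ≤ R / 3) : cutoff R r = 1 :=
  Real.smoothTransition.one_of_one_le (by rw [le_div_iff₀ (by positivity)]; linarith)

theorem cutoff_eq_zero {R r : ℝ} (hR : 0 < R) (h : 2 * R / 3 ≤ r) : cutoff R r = 0 :=
  Real.smoothTransition.zero_of_nonpos (div_nonpos_of_nonpos_of_nonneg (by linarith) (by positivity))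

theorem contDiff_cutoff (R : ℝ) : ContDiff ℝ ∞ (cutoff R) :=
  Real.smoothTransition.contDiff.comp (by fun_prop)

/-- The norm is not smooth at its centre, but the cutoff is constant there. -/
theorem contDiff_cutoff_norm {R : ℝ} (hR : 0 < R) (c : ℂ) :
    ContDiff ℝ ∞ fun z : ℂ => (cutoff R ‖z - c‖ : ℂ) := by
  rw [contDiff_iff_contDiffAt]
  intro z
  by_cases hz : z = c
  · refine (contDiffAt_const (c := (1 : ℂ))).congr_of_eventuallyEq ?_
    filter_upwards [Metric.ball_mem_nhds z (show 0 < R / 3 by positivity)] with w hw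
    rw [hz, mem_ball_iff_norm] at hw
    rw [cutoff_eq_one hR hw.le, ofReal_one]
  · have h1 : ContDiffAt ℝ ∞ (fun z : ℂ => ‖z - c‖) z :=
      (contDiffAt_id.sub contDiffAt_const).norm ℝ (by simpa [sub_eq_zero] using hz)
    exact Complex.ofRealCLM.contDiff.contDiffAt.comp z ((contDiff_cutoff R).contDiffAt.comp z h1)

open Classical in
/-- A cutoff function around `p` that is radial in the chart around `p`. -/
def radialBump (p : X) (R : ℝ) (q : X) : ℂ :=
  if q ∈ (chartAt ℂ p).source then (cutoff R ‖chartAt ℂ p q - chartAt ℂ p p‖ : ℂ) else 0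

section Bump

variable {p : X} {R : ℝ} {V : Set X}

theorem isCompact_bump_support
    (hb : Metric.ball (chartAt ℂ p p) R ⊆ chartAt ℂ p '' V) (hV : V ⊆ (chartAt ℂ p).source)
    (hR : 0 < R) :
    IsCompact ((chartAt ℂ p).symm '' Metric.closedBall (chartAt ℂ p p) (2 * R / 3)) ∧
      (chartAt ℂ p).symm '' Metric.closedBall (chartAt ℂ p p) (2 * R / 3) ⊆ V := by
  have h1 : Metric.closedBall (chartAt ℂ p p) (2 * R / 3) ⊆ chartAt ℂ p '' V :=
    (Metric.closedBall_subset_ball (by linarith)).trans hb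
  constructor
  · refine (isCompact_closedBall _ _).image_of_continuousOn
      ((chartAt ℂ p).continuousOn_symm.mono (h1.trans ?_))
    rintro _ ⟨q, hq, rfl⟩
    exact (chartAt ℂ p).map_source (hV hq)
  · rintro _ ⟨z, hz, rfl⟩
    obtain ⟨q, hq, rfl⟩ := h1 hz
    rwa [(chartAt ℂ p).left_inv (hV hq)]

theorem radialBump_eq_zero (hR : 0 < R) {q : X}
    (hq : q ∉ (chartAt ℂ p).symm '' Metric.closedBall (chartAt ℂ p p) (2 * R / 3)) :
    radialBump p R q = 0 := by
  by_cases hs : q ∈ (chartAt ℂ p).source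
  · rw [radialBump, if_pos hs, cutoff_eq_zero hR, ofReal_zero]
    by_contra! hlt
    exact hq ⟨chartAt ℂ p q, mem_closedBall_iff_norm.2 hlt.le, (chartAt ℂ p).left_inv hs⟩
  · rw [radialBump, if_neg hs]

theorem tsupport_radialBump [T2Space X]
    (hb : Metric.ball (chartAt ℂ p p) R ⊆ chartAt ℂ p '' V) (hV : V ⊆ (chartAt ℂ p).source)
    (hR : 0 < R) : tsupport (radialBump p R) ⊆ V := by
  obtain ⟨hK, hKV⟩ := isCompact_bump_support hb hV hR
  refine (closure_minimal (fun q hq => ?_) hK.isClosed).trans hKV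
  by_contra hn
  exact hq (radialBump_eq_zero hR hn)

theorem radialBump_comp_symm (p : X) (R : ℝ) {z : ℂ} (hz : z ∈ (chartAt ℂ p).target) :
    radialBump p R ((chartAt ℂ p).symm z) = (cutoff R ‖z - chartAt ℂ p p‖ : ℂ) := by
  rw [radialBump, if_pos ((chartAt ℂ p).map_target hz), (chartAt ℂ p).right_inv hz]

/-- Smoothness at the edge of the chart domain uses that the bump vanishes off a compact subset of
that domain, which is closed because X is Hausdorff. -/
theorem isSmoothFun_radialBump [T2Space X] [IsManifold 𝓘(ℂ, ℂ) ω X]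
    (hb : Metric.ball (chartAt ℂ p p) R ⊆ chartAt ℂ p '' V) (hV : V ⊆ (chartAt ℂ p).source)
    (hR : 0 < R) : IsSmoothFun (radialBump p R) := by
  obtain ⟨hK, hKV⟩ := isCompact_bump_support hb hV hR
  intro x z hz
  refine ContDiffAt.contDiffWithinAt ?_
  obtain ⟨q, hq, rfl⟩ : ∃ q ∈ (chartAt ℂ x).source, chartAt ℂ x q = z :=
    ⟨_, (chartAt ℂ x).map_target hz, (chartAt ℂ x).right_inv hz⟩
  by_cases hp : q ∈ (chartAt ℂ p).source
  · have h1 := ((contDiff_cutoff_norm hR (chartAt ℂ p p)).contDiffAt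
      (x := trans x p (chartAt ℂ x q))).comp _ (contDiffAt_trans hq hp)
    refine h1.congr_of_eventuallyEq ?_
    filter_upwards [eventually_symm_mem (chartAt ℂ p).open_source hq hp] with w hw
    simp only [Function.comp_apply, radialBump, if_pos hw.2, trans]
  · refine (contDiffAt_const (c := (0 : ℂ))).congr_of_eventuallyEq ?_
    filter_upwards [eventually_symm_mem hK.isClosed.isOpen_compl hq
      (fun h => hp (hV (hKV h)))] with w hw
    exact radialBump_eq_zero hR hw.2

theorem radialBump_eventuallyEq_one (hR : 0 < R) : radialBump p R =ᶠ[𝓝 p] fun _ => 1 := by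
  have h1 := (chartAt ℂ p).continuousAt (mem_chart_source ℂ p)
  filter_upwards [h1 (Metric.ball_mem_nhds _ (show 0 < R / 3 by positivity)),
    (chartAt ℂ p).open_source.mem_nhds (mem_chart_source ℂ p)] with q hq hs
  rw [radialBump, if_pos hs, cutoff_eq_one hR, ofReal_one]
  have := mem_ball_iff_norm.1 hq
  exact this.le

end Bump

variable {T : Finset X} {U : X → Set X} {θ : X → ℂ → ℂ →L[ℝ] ℂ}

theorem IsClosedForm.integral_wedge_radialBump [T2Space X]
    (h : IsClosedForm T U θ) {p : X} {R : ℝ} (hR : 0 < R)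
    (hb : Metric.ball (chartAt ℂ p p) R ⊆ chartAt ℂ p '' U p)
    (hb' : pball (chartAt ℂ p p) R ⊆ chartAt ℂ p '' (U p \ T)) {w : ℂ}
    (hw : ∀ r ∈ Ioo 0 R, circInt (θ p) (chartAt ℂ p p) r = w) :
    ∫ z in chartAt ℂ p '' U p,
      wedge (fderiv ℝ (radialBump p R ∘ (chartAt ℂ p).symm) z) (θ p z) = -w := by
  rw [← integral_wedge_radial (b := cutoff R) ((contDiff_cutoff R).of_le (by simp))
    (a := R / 3) (R' := 2 * R / 3) (R := R) (by positivity) (by linarith)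
    (fun r hr => cutoff_eq_one hR hr) (fun r hr => cutoff_eq_zero hR hr)
    ((h.contDiffOn p).continuousOn.mono hb') hw]
  refine Eq.trans ?_
    (setIntegral_eq_integral_of_forall_compl_eq_zero (s := chartAt ℂ p '' U p) ?_)
  · refine setIntegral_congr_fun
      (isOpen_chart_image (h.isOpen p) (h.subset p)).measurableSet ?_
    rintro _ ⟨q, hq, rfl⟩
    have : radialBump p R ∘ (chartAt ℂ p).symm =ᶠ[𝓝 (chartAt ℂ p q)]
        fun z => (cutoff R ‖z - chartAt ℂ p p‖ : ℂ) := by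
      filter_upwards [(chartAt ℂ p).open_target.mem_nhds
        ((chartAt ℂ p).map_source (h.subset p hq))] with z hz using radialBump_comp_symm p R hz
    simp only [this.fderiv_eq]
  · intro z hz
    have hz' : z ∈ (Metric.closedBall (chartAt ℂ p p) (2 * R / 3))ᶜ := fun hmem =>
      hz (hb (Metric.closedBall_subset_ball (by linarith) hmem))
    have : (fun z => (cutoff R ‖z - chartAt ℂ p p‖ : ℂ)) =ᶠ[𝓝 z] fun _ => (0 : ℂ) := by
      filter_upwards [Metric.isClosed_closedBall.isOpen_compl.mem_nhds hz'] with w hw'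
      rw [cutoff_eq_zero hR, ofReal_zero]
      by_contra! hlt
      exact hw' (mem_closedBall_iff_norm.2 hlt.le)
    rw [this.fderiv_eq]
    simp [wedge]

/-- A function supported away from `T` transfers to the chart and extends by zero to the plane,
where the planar Stokes theorem applies. -/
theorem IsClosedForm.integral_wedge_eq_zero [T2Space X] [CompactSpace X]
    (h : IsClosedForm T U θ) {x : X} {η : X → ℂ} (hη : IsSmoothFun η)
    (hs : tsupport η ⊆ U x \ T) :
    ∫ z in chartAt ℂ x '' U x, wedge (fderiv ℝ (η ∘ (chartAt ℂ x).symm) z) (θ x z) = 0 := by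
  classical
  have hsrc : tsupport η ⊆ (chartAt ℂ x).source := fun q hq => h.subset x (hs hq).1
  set K := chartAt ℂ x '' tsupport η with hKdef
  have hK : IsCompact K := (isClosed_tsupport η).isCompact.image_of_continuousOn
    ((chartAt ℂ x).continuousOn.mono hsrc)
  set u : ℂ → ℂ := (chartAt ℂ x).target.indicator (η ∘ (chartAt ℂ x).symm) with hu
  have hu0 : ∀ z ∉ K, u z = 0 := fun z hz => by
    by_contra hne
    have hzt : z ∈ (chartAt ℂ x).target := by
      by_contra hn
      exact hne (indicator_of_notMem hn _)
    rw [hu, indicator_of_mem hzt] at hne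
    exact hz ⟨_, subset_tsupport _ hne, (chartAt ℂ x).right_inv hzt⟩
  have huK : tsupport u ⊆ K := closure_minimal
    (fun z hz => by_contra fun hn => hz (hu0 z hn)) hK.isClosed
  have hueq : ∀ z ∈ (chartAt ℂ x).target, u =ᶠ[𝓝 z] η ∘ (chartAt ℂ x).symm := fun z hz => by
    filter_upwards [(chartAt ℂ x).open_target.mem_nhds hz] with w hw
      using indicator_of_mem hw _
  have husm : ContDiff ℝ 1 u := by
    rw [contDiff_iff_contDiffAt]
    intro z
    by_cases hz : z ∈ K
    · obtain ⟨q, hq, rfl⟩ := hz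
      exact ((hη.contDiffAt (hsrc hq)).of_le (by simp)).congr_of_eventuallyEq
        (hueq _ ((chartAt ℂ x).map_source (hsrc hq)))
    · refine (contDiffAt_const (c := (0 : ℂ))).congr_of_eventuallyEq ?_
      filter_upwards [hK.isClosed.isOpen_compl.mem_nhds hz] with w hw using hu0 w hw
  have hopen : IsOpen (chartAt ℂ x '' (U x \ T)) :=
    isOpen_chart_image ((h.isOpen x).sdiff T.finite_toSet.isClosed)
      (sdiff_subset.trans (h.subset x))
  rw [← integral_wedge_fderiv_eq_zero hopen husm (hK.of_isClosed_subset (isClosed_tsupport u) huK)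
    (huK.trans (image_mono hs)) (h.contDiffOn x) (h.closed x)]
  refine Eq.trans ?_
    (setIntegral_eq_integral_of_forall_compl_eq_zero (s := chartAt ℂ x '' U x) ?_)
  · refine setIntegral_congr_fun
      (isOpen_chart_image (h.isOpen x) (h.subset x)).measurableSet ?_
    rintro _ ⟨q, hq, rfl⟩
    simp only [(hueq _ ((chartAt ℂ x).map_source (h.subset x hq))).fderiv_eq]
  · intro z hz
    have hzK : z ∉ tsupport u := fun hm => hz (image_mono (hs.trans sdiff_subset) (huK hm))
    have h0 : u =ᶠ[𝓝 z] fun _ => 0 := notMem_tsupport_iff_eventuallyEq.1 hzK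
    rw [h0.fderiv_eq]
    simp [wedge]

/-- After shrinking, the only point of `T` that the neighbourhood of `x` can contain is `x` itself.
A bump around one point of `T` then vanishes near all the others. -/
theorem IsClosedForm.shrink [T2Space X] (h : IsClosedForm T U θ) :
    IsClosedForm T (fun x => U x \ (T \ {x} : Set X)) θ where
  isOpen x := (h.isOpen x).sdiff (T.finite_toSet.sdiff (t := {x})).isClosed
  mem x := ⟨h.mem x, fun hx => hx.2 rfl⟩
  subset x := sdiff_subset.trans (h.subset x)
  contDiffOn x := (h.contDiffOn x).mono (image_mono (sdiff_subset_sdiff_left sdiff_subset))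
  closed x z hz := h.closed x z (image_mono (sdiff_subset_sdiff_left sdiff_subset) hz)
  change x y q hx hy := h.change x y q hx.1 hy.1

/-- The residue theorem for closed forms on a punctured compact Riemann surface. -/
theorem IsClosedForm.sum_circInt_eq_zero [T2Space X] [CompactSpace X] [IsManifold 𝓘(ℂ, ℂ) ω X]
    (h : IsClosedForm T U θ) (w : X → ℂ)
    (hw : ∀ p ∈ T, ∃ R > 0, ∀ r ∈ Ioo 0 R, circInt (θ p) (chartAt ℂ p p) r = w p) :
    ∑ p ∈ T, w p = 0 := by
  classical
  have h' := h.shrink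
  set U' : X → Set X := fun x => U x \ (T \ {x} : Set X) with hU'
  have hR : ∀ p ∈ T, ∃ R > 0, Metric.ball (chartAt ℂ p p) R ⊆ chartAt ℂ p '' U' p ∧
      ∀ r ∈ Ioo 0 R, circInt (θ p) (chartAt ℂ p p) r = w p := by
    intro p hp
    obtain ⟨R₁, hR₁, hw₁⟩ := hw p hp
    obtain ⟨R₂, hR₂, hb⟩ := Metric.isOpen_iff.1 (isOpen_chart_image (h'.isOpen p) (h'.subset p))
      (chartAt ℂ p p) ⟨p, h'.mem p, rfl⟩
    exact ⟨min R₁ R₂, lt_min hR₁ hR₂, (Metric.ball_subset_ball (min_le_right _ _)).trans hb,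
      fun r hr => hw₁ r ⟨hr.1, hr.2.trans_le (min_le_left _ _)⟩⟩
  choose! R hR0 hRb hRw using hR
  have hpb : ∀ p ∈ T, pball (chartAt ℂ p p) (R p) ⊆ chartAt ℂ p '' (U' p \ T) := by
    rintro p hp z ⟨hz, hzp⟩
    obtain ⟨q, hq, rfl⟩ := hRb p hp hz
    refine ⟨q, ⟨hq, fun hqT => hq.2 ⟨hqT, fun hqp => hzp ?_⟩⟩, rfl⟩
    rw [mem_singleton_iff] at hqp ⊢
    rw [hqp]
  obtain ⟨F, ρ, hρ, hρs, hρ1⟩ := exists_partitionOfUnity h'.isOpen h'.mem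
  set β : X → X → ℂ := fun p => radialBump p (R p) with hβ
  have hβs : ∀ p ∈ T, IsSmoothFun (β p) := fun p hp =>
    isSmoothFun_radialBump (hRb p hp) (h'.subset p) (hR0 p hp)
  have hβt : ∀ p ∈ T, tsupport (β p) ⊆ U' p := fun p hp =>
    tsupport_radialBump (hRb p hp) (h'.subset p) (hR0 p hp)
  have hβ0 : ∀ p ∈ T, ∀ q ∈ T, q ≠ p → β p =ᶠ[𝓝 q] fun _ => 0 := fun p hp q hq hne =>
    notMem_tsupport_iff_eventuallyEq.1 fun hm => (hβt p hp hm).2 ⟨hq, hne⟩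
  have hβ1 : ∀ p ∈ T, β p =ᶠ[𝓝 p] fun _ => 1 := fun p hp =>
    radialBump_eventuallyEq_one (hR0 p hp)
  -- The bumps β are completed to a partition of unity by the functions κρ, which vanish near `T`.
  -- The bumps contribute the circle integrals with a minus sign; the other members contribute
  -- nothing.
  set κ : X → ℂ := fun q => 1 - ∑ p ∈ T, β p q with hκ
  have hκs : IsSmoothFun κ := isSmoothFun_one_sub_sum T hβs
  have hκ0 : ∀ q ∈ T, κ =ᶠ[𝓝 q] fun _ => 0 := fun q hq => by
    have hall : ∀ᶠ y in 𝓝 q, ∀ p ∈ T, p ≠ q → β p y = 0 := by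
      rw [Filter.eventually_all_finset]
      intro p hp
      by_cases hpq : p = q
      · exact Eventually.of_forall fun y hy => absurd hpq hy
      · filter_upwards [hβ0 p hp q hq (Ne.symm hpq)] with y hy _ using hy
    filter_upwards [hall, hβ1 q hq] with y hy hy1
    simp only [hκ]
    rw [Finset.sum_eq_single_of_mem q hq fun p hp hpq => hy p hp hpq, hy1, sub_self]
  let η : T ⊕ F → X → ℂ := Sum.elim (fun p => β p) (fun x q => κ q * ρ x q)
  let c : T ⊕ F → X := Sum.elim (fun p => p) (fun x => x)
  have hreg : ∀ x : X, tsupport (fun q => κ q * ρ x q) ⊆ U' x \ T := fun x q hq => by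
    refine ⟨hρs x (closure_mono (fun y hy => ?_) hq), fun hqT => ?_⟩
    · exact right_ne_zero_of_mul hy
    · refine notMem_tsupport_iff_eventuallyEq.2 ?_ hq
      filter_upwards [hκ0 q hqT] with y hy
      simp [hy]
  have key := h'.sum_integral_eq_zero c η ?_ ?_ ?_ ?_
  · rw [Fintype.sum_sum_type] at key
    have h2 : ∀ x : F, ∫ z in chartAt ℂ (c (Sum.inr x)) '' U' (c (Sum.inr x)),
        wedge (fderiv ℝ (η (Sum.inr x) ∘ (chartAt ℂ (c (Sum.inr x))).symm) z)
          (θ (c (Sum.inr x)) z) = 0 := fun x =>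
      h'.integral_wedge_eq_zero (hκs.mul (hρ x)) (hreg x)
    have h1 : ∀ p : T, ∫ z in chartAt ℂ (c (Sum.inl p)) '' U' (c (Sum.inl p)),
        wedge (fderiv ℝ (η (Sum.inl p) ∘ (chartAt ℂ (c (Sum.inl p))).symm) z)
          (θ (c (Sum.inl p)) z) = -w p := fun p =>
      h'.integral_wedge_radialBump (hR0 p p.2) (hRb p p.2) (hpb p p.2) (hRw p p.2)
    rw [Finset.sum_congr rfl fun p _ => h1 p, Finset.sum_congr rfl fun x _ => h2 x] at key
    rw [Finset.sum_const_zero, add_zero, Finset.sum_neg_distrib, neg_eq_zero] at key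
    rw [← key, ← Finset.sum_coe_sort T]
  · rintro (p | x)
    · exact hβs p p.2
    · exact hκs.mul (hρ x)
  · rintro (p | x)
    · exact hβt p p.2
    · exact (hreg x).trans sdiff_subset
  · rintro (p | x) q hq
    · by_cases hqp : q = p
      · exact ⟨1, by rw [hqp]; exact hβ1 p p.2⟩
      · exact ⟨0, hβ0 p p.2 q hq hqp⟩
    · exact ⟨0, notMem_tsupport_iff_eventuallyEq.1 fun hm => (hreg x hm).2 hq⟩
  · intro q
    rw [Fintype.sum_sum_type]
    simp only [η, Sum.elim_inl, Sum.elim_inr]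
    rw [← Finset.mul_sum, Finset.sum_coe_sort F (fun x => ρ x q), hρ1,
      Finset.sum_coe_sort T (fun p => β p q)]
    simp [hκ]

end Residue

/-! ### Circle integrals and closedness of the forms k dz and dF / F. -/

theorem circInt_mulReal (k : ℂ → ℂ) (p : ℂ) (r : ℝ) :
    circInt (fun z => mulReal (k z)) p r = ∮ z in C(p, r), k z := by
  rw [circInt, circleIntegral]
  have hper : Function.Periodic
      (fun t : ℝ => deriv (circleMap p r) t • k (circleMap p r t)) (2 * Real.pi) := by
    intro t
    simp only [deriv_circleMap, periodic_circleMap p r t, periodic_circleMap 0 r t]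
  have h := hper.intervalIntegral_add_eq 0 (-Real.pi)
  rw [zero_add, show -Real.pi + 2 * Real.pi = Real.pi by ring] at h
  rw [h]
  refine intervalIntegral.integral_congr fun t _ => ?_
  simp only [mulReal_apply, deriv_circleMap, smul_eq_mul, circ, circleMap]
  ring

theorem circInt_congr {θ θ' : ℂ → ℂ →L[ℝ] ℂ} {p : ℂ} {R r : ℝ} (hr : r ∈ Ioo 0 R)
    (h : ∀ z ∈ pball p R, θ z = θ' z) : circInt θ p r = circInt θ' p r := by
  refine intervalIntegral.integral_congr fun t _ => ?_
  simp only [h _ (circ_mem_pball hr t)]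

theorem circInt_add {θ θ' : ℂ → ℂ →L[ℝ] ℂ} {p : ℂ} {R r : ℝ} (hr : r ∈ Ioo 0 R)
    (h : ContinuousOn θ (pball p R)) (h' : ContinuousOn θ' (pball p R)) :
    circInt (fun z => θ z + θ' z) p r = circInt θ p r + circInt θ' p r := by
  have hc {θ : ℂ → ℂ →L[ℝ] ℂ} (h : ContinuousOn θ (pball p R)) :
      Continuous fun t : ℝ => θ (circ p r t) (I * r * cexp (t * I)) :=
    (continuousOn_circ_form h).comp_continuous
      (f := fun t : ℝ => (r, t)) (by fun_prop) (fun x => ⟨hr, mem_univ _⟩)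
  rw [circInt, circInt, circInt, ← intervalIntegral.integral_add
    ((hc h).intervalIntegrable _ _) ((hc h').intervalIntegrable _ _)]
  simp

theorem circInt_mulReal_eq_zero {e : ℂ → ℂ} {p : ℂ} {R r : ℝ} (hr : r ∈ Ioo 0 R)
    (he : DifferentiableOn ℂ e (Metric.ball p R)) : circInt (fun z => mulReal (e z)) p r = 0 := by
  rw [circInt_mulReal]
  refine DiffContOnCl.circleIntegral_eq_zero hr.1.le (DifferentiableOn.diffContOnCl ?_)
  exact he.mono (Metric.closure_ball_subset_closedBall.trans (Metric.closedBall_subset_ball hr.2))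

theorem circInt_mulReal_inv_mul {e : ℂ → ℂ} {p : ℂ} {R r : ℝ} (hr : r ∈ Ioo 0 R)
    (he : DifferentiableOn ℂ e (Metric.ball p R)) :
    circInt (fun z => mulReal ((z - p)⁻¹ * e z)) p r = 2 * Real.pi * I * e p := by
  rw [circInt_mulReal]
  exact DifferentiableOn.circleIntegral_sub_inv_smul
    (he.mono (Metric.closedBall_subset_ball hr.2)) (Metric.mem_ball_self hr.1)

/-- Closedness of dF / F: the second derivative of F is symmetric, and the remaining term is a
multiple of the symmetric product dF ⊗ dF. -/
theorem fderiv_dlog_comm {F : ℂ → ℂ} {z : ℂ} (hF : ContDiffAt ℝ 2 F z) (h0 : F z ≠ 0) (v w : ℂ) :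
    fderiv ℝ (dlog F) z v w = fderiv ℝ (dlog F) z w v := by
  have hd : DifferentiableAt ℝ F z := hF.differentiableAt (by norm_num)
  have hd2 : DifferentiableAt ℝ (fderiv ℝ F) z :=
    (hF.fderiv_right (m := 1) (by norm_num)).differentiableAt (by norm_num)
  have hsymm : IsSymmSndFDerivAt ℝ F z := hF.isSymmSndFDerivAt (by simp)
  have h1 : HasFDerivAt (fun z => (F z)⁻¹) (-(F z ^ 2)⁻¹ • fderiv ℝ F z) z := by
    have := (hasDerivAt_inv h0).hasFDerivAt.restrictScalars ℝ |>.comp z hd.hasFDerivAt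
    convert! this using 1
    ext v
    simp [mul_comm]
  have h2 := h1.smul hd2.hasFDerivAt
  have h3 : fderiv ℝ (dlog F) z = _ := h2.fderiv
  rw [h3]
  simp [hsymm.eq v w]
  ring

theorem contDiffAt_dlog {F : ℂ → ℂ} {z : ℂ} (hF : ContDiffAt ℝ 2 F z) (h0 : F z ≠ 0) :
    ContDiffAt ℝ 1 (dlog F) z :=
  ((hF.of_le (by norm_num)).inv h0).smul (hF.fderiv_right (m := 1) (by norm_num))

theorem fderiv_mulReal {k : ℂ → ℂ} {z : ℂ} (hk : DifferentiableAt ℂ k z) (v w : ℂ) :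
    fderiv ℝ (fun z => mulReal (k z)) z v w = deriv k z * v * w := by
  have h1 : HasFDerivAt (fun z => mulReal (k z))
      ((mulReal (deriv k z)).smulRight (ContinuousLinearMap.id ℝ ℂ)) z := by
    have := (hasFDerivAt_mulReal hk).smul_const (ContinuousLinearMap.id ℝ ℂ)
    exact this
  rw [h1.fderiv]
  simp

theorem contDiffAt_mulReal {k : ℂ → ℂ} {z : ℂ} (hk : ContDiffAt ℝ 1 k z) :
    ContDiffAt ℝ 1 (fun z => mulReal (k z)) z := hk.smul contDiffAt_const

/-! ### Logarithmic connections on line bundles and the form Dσ / σ. -/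

section LineData

variable {X : Type*} [TopologicalSpace X] [ChartedSpace ℂ X]

open Classical in
/-- The coefficient of `dt / t` or `dt` in the chart around `x`. -/
def pole (S : Finset X) (x : X) (z : ℂ) : ℂ := if x ∈ S then (z - chartAt ℂ x x)⁻¹ else 1

/-- A line bundle with a logarithmic connection, in terms of its transition functions `g x y` and
its connection forms `a x dt / t` or `a x dt` on the coordinate neighbourhoods `U x`. -/
structure IsLogLineData (S : Finset X) (U : X → Set X) (g : X → X → X → ℂ) (a : X → ℂ → ℂ) :
    Prop where
  isOpen : ∀ x, IsOpen (U x)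
  mem : ∀ x, x ∈ U x
  subset : ∀ x, U x ⊆ (chartAt ℂ x).source
  differentiableOn : ∀ x, DifferentiableOn ℂ (a x) (chartAt ℂ x '' U x)
  differentiableOn_transition : ∀ x y,
    DifferentiableOn ℂ (g x y ∘ (chartAt ℂ x).symm) (chartAt ℂ x '' (U x ∩ U y))
  ne_zero : ∀ x y, ∀ q ∈ U x ∩ U y, g x y q ≠ 0
  cocycle : ∀ x y z, ∀ q ∈ U x ∩ U y ∩ U z, g x z q = g x y q * g y z q
  change : ∀ x y q, q ∈ U x → q ∈ U y → q ∉ S →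
    pole S y (chartAt ℂ y q) * a y (chartAt ℂ y q) * deriv (trans x y) (chartAt ℂ x q) =
      pole S x (chartAt ℂ x q) * a x (chartAt ℂ x q) +
        deriv (g x y ∘ (chartAt ℂ x).symm) (chartAt ℂ x q) / g x y q

variable {S T : Finset X} {U : X → Set X} {g : X → X → X → ℂ} {a : X → ℂ → ℂ}

/-- A nowhere vanishing smooth section over the complement of `T`, given by its coordinates. -/
structure IsSmoothSection (T : Finset X) (U : X → Set X) (g : X → X → X → ℂ) (f : X → X → ℂ) :
    Prop where
  contDiffAt : ∀ x, ∀ q ∈ U x, q ∉ T → ContDiffAt ℝ 2 (f x ∘ (chartAt ℂ x).symm) (chartAt ℂ x q)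
  ne_zero : ∀ x, ∀ q ∈ U x, q ∉ T → f x q ≠ 0
  eq_mul : ∀ x y, ∀ q ∈ U x ∩ U y, q ∉ T → f x q = g x y q * f y q

theorem IsLogLineData.differentiableAt_transition (h : IsLogLineData S U g a) {x y q : X}
    (hx : q ∈ U x) (hy : q ∈ U y) :
    DifferentiableAt ℂ (g x y ∘ (chartAt ℂ x).symm) (chartAt ℂ x q) :=
  (h.differentiableOn_transition x y).differentiableAt ((isOpen_chart_image
    ((h.isOpen x).inter (h.isOpen y)) (inter_subset_left.trans (h.subset x))).mem_nhds
    ⟨q, ⟨hx, hy⟩, rfl⟩)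

theorem differentiableAt_pole {x q : X} (hq : q ∈ (chartAt ℂ x).source) (h : q ∉ S) :
    DifferentiableAt ℂ (pole S x) (chartAt ℂ x q) := by
  unfold pole
  split_ifs with hx
  · refine (differentiableAt_id.sub_const _).inv ?_
    refine sub_ne_zero.2 fun he => ?_
    change chartAt ℂ x q = chartAt ℂ x x at he
    rw [(chartAt ℂ x).injOn hq (mem_chart_source ℂ x) he] at h
    exact h hx
  · exact differentiableAt_const _

theorem IsLogLineData.eventually_differentiableAt [T2Space X] (h : IsLogLineData S U g a) {x q : X}
    (hx : q ∈ U x) (hq : q ∉ S) :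
    ∀ᶠ z in 𝓝 (chartAt ℂ x q), DifferentiableAt ℂ (fun z => pole S x z * a x z) z := by
  have hopen : IsOpen (chartAt ℂ x '' (U x \ S)) :=
    isOpen_chart_image ((h.isOpen x).sdiff S.finite_toSet.isClosed)
      (sdiff_subset.trans (h.subset x))
  filter_upwards [hopen.mem_nhds ⟨q, ⟨hx, hq⟩, rfl⟩]
  rintro _ ⟨q', hq', rfl⟩
  exact (differentiableAt_pole (h.subset x hq'.1) hq'.2).mul
    ((h.differentiableOn x).differentiableAt
      ((isOpen_chart_image (h.isOpen x) (h.subset x)).mem_nhds ⟨q', hq'.1, rfl⟩))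

theorem contDiffAt_real {k : ℂ → ℂ} {z : ℂ} (h : ∀ᶠ w in 𝓝 z, DifferentiableAt ℂ k w)
    (n : ℕ∞ω) : ContDiffAt ℝ n k z := by
  have h1 : AnalyticAt ℂ k z := Complex.analyticAt_iff_eventually_differentiableAt.2 h
  exact h1.contDiffAt.restrict_scalars ℝ

/-- For a section σ with coordinate f_x in the frame at x, this is the form Dσ / σ. Replacing the
frame adds dg / g to the connection form and removes it from df / f, so the local expressions agree.
Each is closed: one summand is a logarithmic differential, the other a holomorphic form. -/
theorem IsLogLineData.isClosedForm [T2Space X] [IsManifold 𝓘(ℂ, ℂ) ω X]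
    (h : IsLogLineData S U g a) {f : X → X → ℂ} (hST : S ⊆ T) (hf : IsSmoothSection T U g f) :
    IsClosedForm T U fun x z =>
      dlog (f x ∘ (chartAt ℂ x).symm) z + mulReal (pole S x z * a x z) where
  isOpen := h.isOpen
  mem := h.mem
  subset := h.subset
  contDiffOn x := by
    rintro _ ⟨q, ⟨hq, hqT⟩, rfl⟩
    refine ContDiffAt.contDiffWithinAt ((contDiffAt_dlog (hf.contDiffAt x q hq hqT) ?_).add
      (contDiffAt_mulReal (contDiffAt_real
        (h.eventually_differentiableAt hq fun hS => hqT (hST hS)) 1)))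
    simpa [(chartAt ℂ x).left_inv (h.subset x hq)] using hf.ne_zero x q hq hqT
  closed x := by
    rintro _ ⟨q, ⟨hq, hqT⟩, rfl⟩
    have h0 : (f x ∘ (chartAt ℂ x).symm) (chartAt ℂ x q) ≠ 0 := by
      simpa [(chartAt ℂ x).left_inv (h.subset x hq)] using hf.ne_zero x q hq hqT
    have hk := h.eventually_differentiableAt hq fun hS => hqT (hST hS)
    have h1 := (contDiffAt_dlog (hf.contDiffAt x q hq hqT) h0).differentiableAt (by norm_num)
    have h2 := (contDiffAt_mulReal (contDiffAt_real hk 1)).differentiableAt (by norm_num)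
    rw [fderiv_fun_add h1 h2, add_apply, add_apply, add_apply, add_apply,
      fderiv_dlog_comm (hf.contDiffAt x q hq hqT) h0, fderiv_mulReal hk.self_of_nhds,
      fderiv_mulReal hk.self_of_nhds]
    ring
  change x y q hx hy hqT := by
    have hqS : q ∉ S := fun hS => hqT (hST hS)
    have hsx := h.subset x hx
    have hsy := h.subset y hy
    have hev : f x ∘ (chartAt ℂ x).symm =ᶠ[𝓝 (chartAt ℂ x q)]
        fun z => (g x y ∘ (chartAt ℂ x).symm) z * (f y ∘ (chartAt ℂ x).symm) z := by
      filter_upwards [eventually_symm_mem (((h.isOpen x).inter (h.isOpen y)).sdiff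
        T.finite_toSet.isClosed) hsx ⟨⟨hx, hy⟩, hqT⟩] with z hz
      exact hf.eq_mul x y _ hz.2.1 hz.2.2
    have hfy : DifferentiableAt ℝ (f y ∘ (chartAt ℂ y).symm) (chartAt ℂ y q) :=
      (hf.contDiffAt y q hy hqT).differentiableAt (by norm_num)
    have hfx : DifferentiableAt ℝ (f y ∘ (chartAt ℂ x).symm) (chartAt ℂ x q) := by
      refine DifferentiableAt.congr_of_eventuallyEq ?_ (comp_symm_eventuallyEq (f y) hsx hsy)
      rw [← trans_apply (y := y) hsx] at hfy
      exact hfy.comp _ (hasFDerivAt_mulReal (differentiableAt_trans hsx hsy)).differentiableAt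
    have hg := hasFDerivAt_mulReal (h.differentiableAt_transition hx hy)
    have hfd : fderiv ℝ (f x ∘ (chartAt ℂ x).symm) (chartAt ℂ x q) = g x y q •
        (fderiv ℝ (f y ∘ (chartAt ℂ y).symm) (chartAt ℂ y q)).comp
        (mulReal (deriv (trans x y) (chartAt ℂ x q))) +
        f y q • mulReal (deriv (g x y ∘ (chartAt ℂ x).symm) (chartAt ℂ x q)) := by
      rw [hev.fderiv_eq, ← fderiv_comp_symm hsx hsy hfy]
      have := (hg.mul hfx.hasFDerivAt).fderiv
      simpa [(chartAt ℂ x).left_inv hsx] using! this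
    have hgne := h.ne_zero x y q ⟨hx, hy⟩
    have hfne := hf.ne_zero y q hy hqT
    have hch := h.change x y q hx hy hqS
    refine ContinuousLinearMap.ext fun v => ?_
    simp only [dlog, add_apply, smul_apply, ContinuousLinearMap.comp_apply, hfd, mulReal_apply,
      Function.comp_apply, (chartAt ℂ x).left_inv hsx, (chartAt ℂ y).left_inv hsy, smul_eq_mul,
      hf.eq_mul x y q ⟨hx, hy⟩ hqT]
    rw [← mul_assoc (pole S y _ * a y _), hch]
    field_simp
    ring

/-- The sum of the orders of a section and of the residues of the connection is zero. -/
theorem IsLogLineData.sum_residue [T2Space X] [CompactSpace X] [IsManifold 𝓘(ℂ, ℂ) ω X]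
    (h : IsLogLineData S U g a) {f : X → X → ℂ} (hST : S ⊆ T) (hf : IsSmoothSection T U g f)
    (N : X → ℂ) (hN : ∀ p ∈ T, ∃ R > 0, ∀ r ∈ Ioo 0 R,
      circInt (dlog (f p ∘ (chartAt ℂ p).symm)) (chartAt ℂ p p) r = 2 * Real.pi * I * N p) :
    ∑ p ∈ T, N p + ∑ p ∈ S, a p (chartAt ℂ p p) = 0 := by
  classical
  have hcl := h.isClosedForm hST hf
  have key := hcl.sum_circInt_eq_zero
    (fun p => 2 * Real.pi * I * (N p + if p ∈ S then a p (chartAt ℂ p p) else 0)) ?_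
  · rw [← Finset.mul_sum, Finset.sum_add_distrib, ← Finset.sum_filter,
      Finset.filter_mem_eq_inter, Finset.inter_eq_right.2 hST] at key
    simpa [Real.pi_ne_zero] using key
  · intro p hp
    obtain ⟨R₁, hR₁, hw₁⟩ := hN p hp
    obtain ⟨R₂, hR₂, hb⟩ := Metric.isOpen_iff.1 (isOpen_chart_image (hcl.shrink.isOpen p)
      (hcl.shrink.subset p)) (chartAt ℂ p p) ⟨p, hcl.shrink.mem p, rfl⟩
    have hbU : Metric.ball (chartAt ℂ p p) R₂ ⊆ chartAt ℂ p '' U p :=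
      hb.trans (image_mono sdiff_subset)
    have ha := (h.differentiableOn p).mono hbU
    have hpb : ∀ z ∈ pball (chartAt ℂ p p) R₂, ∃ q ∈ U p, q ∉ T ∧ chartAt ℂ p q = z := by
      rintro z ⟨hz, hzp⟩
      obtain ⟨q, hq, rfl⟩ := hb hz
      refine ⟨q, hq.1, fun hqT => hq.2 ⟨hqT, fun hqp => hzp ?_⟩, rfl⟩
      rw [mem_singleton_iff] at hqp ⊢
      rw [hqp]
    have hc1 : ContinuousOn (dlog (f p ∘ (chartAt ℂ p).symm)) (pball (chartAt ℂ p p) R₂) := by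
      intro z hz
      obtain ⟨q, hq, hqT, rfl⟩ := hpb z hz
      refine (contDiffAt_dlog (hf.contDiffAt p q hq hqT) ?_).continuousAt.continuousWithinAt
      simpa [(chartAt ℂ p).left_inv (h.subset p hq)] using hf.ne_zero p q hq hqT
    have hc2 : ContinuousOn (fun z => mulReal (pole S p z * a p z))
        (pball (chartAt ℂ p p) R₂) := by
      intro z hz
      obtain ⟨q, hq, hqT, rfl⟩ := hpb z hz
      exact (contDiffAt_mulReal (contDiffAt_real (h.eventually_differentiableAt hq
        fun hS => hqT (hST hS)) 1)).continuousAt.continuousWithinAt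
    refine ⟨min R₁ R₂, lt_min hR₁ hR₂, fun r hr => ?_⟩
    have hr₁ : r ∈ Ioo 0 R₁ := ⟨hr.1, hr.2.trans_le (min_le_left _ _)⟩
    have hr₂ : r ∈ Ioo 0 R₂ := ⟨hr.1, hr.2.trans_le (min_le_right _ _)⟩
    rw [circInt_add hr₂ hc1 hc2, hw₁ r hr₁, mul_add]
    congr 1
    -- At a point of `S`, Cauchy's integral formula extracts the residue from a dt / t. Elsewhere
    -- the connection form is holomorphic and integrates to zero.
    unfold pole
    split_ifs with hpS
    · exact circInt_mulReal_inv_mul hr₂ ha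
    · simp only [one_mul, mul_zero]
      exact circInt_mulReal_eq_zero hr₂ ha

end LineData

/-! ### Sard's argument for generic linear combinations. -/

/-- A generic linear combination of functions, with one of them constant, has zero as a
regular value. -/
theorem ae_injective_fderiv {ι : Type*} [Fintype ι] [DecidableEq ι] (i : ι) (O : Set ℂ)
    (u : ι → ℂ → ℂ) (hu : ∀ j, ∀ z ∈ O, DifferentiableAt ℝ (u j) z) :
    ∀ᵐ c : ι → ℂ, ∀ z ∈ O, c i + ∑ j ∈ Finset.univ.erase i, c j * u j z = 0 →
      Function.Injective (fderiv ℝ (fun z => ∑ j ∈ Finset.univ.erase i, c j * u j z) z) := by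
  set ψ : (ι → ℂ) → ℂ → ℂ := fun b z => ∑ j ∈ Finset.univ.erase i, b j * u j z with hψ
  have hψd : ∀ b, ∀ z ∈ O, DifferentiableAt ℝ (ψ b) z := fun b z hz =>
    DifferentiableAt.fun_sum fun j _ => (hu j z hz).const_mul (b j)
  -- The vector b encodes coefficients c_j for j ≠ i together with a point z = b_i, and Φ fills in
  -- the i-th coefficient so that the combination vanishes at z. The bad coefficient vectors are
  -- values of Φ at the points of `Z`, where its derivative is degenerate, so they form a null set.
  set Φ : (ι → ℂ) → (ι → ℂ) := fun b => Function.update b i (-ψ b (b i)) with hΦ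
  set Z : Set (ι → ℂ) := {b | b i ∈ O ∧ ¬ Function.Injective (fderiv ℝ (ψ b) (b i))} with hZ
  have hψu : ∀ b z, ψ (Function.update b i z) = ψ b := fun b z => by
    funext w
    refine Finset.sum_congr rfl fun j hj => ?_
    rw [Function.update_of_ne (Finset.ne_of_mem_erase hj)]
  have hΦd : ∀ b, b i ∈ O → DifferentiableAt ℝ Φ b := by
    intro b hb
    rw [differentiableAt_pi]
    intro j
    by_cases hj : j = i
    · subst hj
      have : (fun b => Φ b j) = fun b => -∑ k ∈ Finset.univ.erase j, b k * u k (b j) := by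
        funext b; simp [hΦ, hψ]
      rw [this]
      refine (DifferentiableAt.fun_sum fun k _ => ?_).neg
      exact (differentiableAt_apply k b).mul ((hu k _ hb).comp b (differentiableAt_apply j b))
    · have : (fun b => Φ b j) = fun b => b j := by
        funext b; simp [hΦ, Function.update_of_ne hj]
      rw [this]
      exact differentiableAt_apply j b
  have hdet : ∀ b ∈ Z, (fderiv ℝ Φ b).det = 0 := by
    rintro b ⟨hb, hninj⟩
    by_contra hdet
    have hinj : Function.Injective (fderiv ℝ Φ b) :=
      (LinearMap.equivOfDetNeZero (fderiv ℝ Φ b : (ι → ℂ) →ₗ[ℝ] (ι → ℂ)) hdet).injective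
    -- Varying only b_i changes only the i-th coordinate of Φ, by -ψ. A kernel vector of the
    -- derivative of ψ therefore gives one of the derivative of Φ.
    refine hninj ((injective_iff_map_eq_zero _).2 fun w hw => ?_)
    have h1 : HasFDerivAt (fun z : ℂ => Φ (Function.update b i z))
        ((fderiv ℝ Φ b).comp
          (ContinuousLinearMap.pi (Pi.single i (ContinuousLinearMap.id ℝ ℂ)))) (b i) := by
      refine HasFDerivAt.comp (g := Φ) (f := Function.update b i) (b i) ?_
        (hasFDerivAt_update b (b i))
      rw [Function.update_eq_self]
      exact (hΦd b hb).hasFDerivAt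
    have h2 : HasFDerivAt (fun z : ℂ => Φ (Function.update b i z))
        ((ContinuousLinearMap.pi (Pi.single i (ContinuousLinearMap.id ℝ ℂ))).comp
          (-fderiv ℝ (ψ b) (b i)) : ℂ →L[ℝ] ι → ℂ) (b i) := by
      have h3 : (fun z : ℂ => Φ (Function.update b i z)) =
          (Function.update b i) ∘ fun z => -ψ b z := by
        funext z
        simp [hΦ, hψu]
      rw [h3]
      exact (hasFDerivAt_update b _).comp (b i) (hψd b _ hb).hasFDerivAt.neg
    have h4 := congrArg (fun L => L w) (h1.unique h2)
    simp only [ContinuousLinearMap.comp_apply, neg_apply, hw, neg_zero, map_zero] at h4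
    have h5 := congrFun (hinj (h4.trans (map_zero _).symm)) i
    simpa using h5
  have hnull : volume (Φ '' Z) = 0 := addHaar_image_eq_zero_of_det_fderivWithin_eq_zero volume
    (fun b hb => (hΦd b hb.1).hasFDerivAt.hasFDerivWithinAt) hdet
  filter_upwards [measure_eq_zero_iff_ae_notMem.1 hnull] with c hc z hz h0
  by_contra hninj
  refine hc ⟨Function.update c i z, ⟨by simpa using hz, ?_⟩, ?_⟩
  · rw [hψu, Function.update_self]
    exact hninj
  · simp only [hΦ, hψu, Function.update_self, Function.update_idem]
    rw [show -ψ c z = c i from by rw [neg_eq_iff_add_eq_zero, add_comm]; exact h0]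
    simp

/-- An injective derivative is bounded below, so F takes each value at most in isolation near z.
Regular zeros are therefore isolated even without holomorphy. -/
theorem eventually_ne_of_injective {F : ℂ → ℂ} {z : ℂ} (hF : DifferentiableAt ℝ F z)
    (h : Function.Injective (fderiv ℝ F z)) (c : ℂ) : ∀ᶠ w in 𝓝[≠] z, F w ≠ c := by
  obtain ⟨K, -, hK⟩ := LinearMap.exists_antilipschitzWith (fderiv ℝ F z : ℂ →ₗ[ℝ] ℂ)
    (LinearMap.ker_eq_bot.2 h)
  exact hF.hasFDerivAt.eventually_ne ⟨K, hK⟩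

theorem finite_of_eventually_notMem {X : Type*} [TopologicalSpace X] [CompactSpace X] {A : Set X}
    (h : ∀ q, ∀ᶠ q' in 𝓝[≠] q, q' ∉ A) : A.Finite := by
  by_contra hA
  obtain ⟨q, hq⟩ := Set.Infinite.exists_accPt_principal hA
  exact (accPt_iff_frequently_nhdsNE.1 hq) (by simpa using h q)

/-! ### Sections with isolated zeros, integrality of the residue sum, and degree. -/

section LineData

variable {X : Type*} [TopologicalSpace X] [ChartedSpace ℂ X]

theorem tendsto_chart_nhdsNE {x q : X} (hx : q ∈ (chartAt ℂ x).source) :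
    Tendsto (chartAt ℂ x) (𝓝[≠] q) (𝓝[≠] (chartAt ℂ x q)) := by
  refine tendsto_nhdsWithin_iff.2
    ⟨((chartAt ℂ x).continuousAt hx).tendsto.mono_left nhdsWithin_le_nhds, ?_⟩
  filter_upwards [self_mem_nhdsWithin,
    mem_nhdsWithin_of_mem_nhds ((chartAt ℂ x).open_source.mem_nhds hx)] with q' hne hs he
  exact hne ((chartAt ℂ x).injOn hs hx he)

variable {S : Finset X} {U : X → Set X} {g : X → X → X → ℂ} {a : X → ℂ → ℂ}

theorem IsLogLineData.transition_self (h : IsLogLineData S U g a) {x q : X} (hq : q ∈ U x) :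
    g x x q = 1 := by
  have h1 := h.cocycle x x x q ⟨⟨hq, hq⟩, hq⟩
  have h2 := h.ne_zero x x q ⟨hq, hq⟩
  field_simp at h1
  exact h1.symm

theorem IsLogLineData.contDiffAt_transition (h : IsLogLineData S U g a) {x y q : X}
    (hx : q ∈ U x) (hy : q ∈ U y) (n : ℕ∞ω) :
    ContDiffAt ℝ n (g x y ∘ (chartAt ℂ x).symm) (chartAt ℂ x q) := by
  refine contDiffAt_real ?_ n
  have hopen := isOpen_chart_image ((h.isOpen x).inter (h.isOpen y))
    (inter_subset_left.trans (h.subset x))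
  filter_upwards [hopen.mem_nhds ⟨q, ⟨hx, hy⟩, rfl⟩] with z hz
  exact (h.differentiableOn_transition x y).differentiableAt (hopen.mem_nhds hz)

/-- Coordinate in the frame around `x` of a linear combination of truncated local frames. -/
def combination (F : Finset X) (ρ : X → X → ℂ) (g : X → X → X → ℂ) (c : F → ℂ) (x q : X) : ℂ :=
  ∑ i : F, c i * (ρ i q * g x i q)

variable {F : Finset X} {ρ : X → X → ℂ}

/-- Off the domain of the transition function the product is zero, because the support of ρ lies in
`U i`. -/
theorem IsLogLineData.contDiffAt_mul_transition (h : IsLogLineData S U g a)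
    {ρ : X → ℂ} {i : X} (hρ : IsSmoothFun ρ) (hρs : tsupport ρ ⊆ U i)
    {x q : X} (hq : q ∈ U x) :
    ContDiffAt ℝ 2 ((fun q => ρ q * g x i q) ∘ (chartAt ℂ x).symm) (chartAt ℂ x q) := by
  by_cases hqi : q ∈ tsupport ρ
  · exact ((hρ.contDiffAt (h.subset x hq)).of_le (WithTop.coe_le_coe.2 (le_top (a := (2 : ℕ∞))))).mul
      (h.contDiffAt_transition hq (hρs hqi) 2)
  · refine (contDiffAt_const (c := (0 : ℂ))).congr_of_eventuallyEq ?_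
    filter_upwards [eventually_symm_mem (isClosed_tsupport ρ).isOpen_compl (h.subset x hq) hqi]
      with z hz
    simp [image_eq_zero_of_notMem_tsupport hz.2]

theorem IsLogLineData.contDiffAt_combination (h : IsLogLineData S U g a)
    (hρ : ∀ x, IsSmoothFun (ρ x)) (hρs : ∀ x, tsupport (ρ x) ⊆ U x) (c : F → ℂ)
    {x q : X} (hq : q ∈ U x) :
    ContDiffAt ℝ 2 (combination F ρ g c x ∘ (chartAt ℂ x).symm) (chartAt ℂ x q) :=
  ContDiffAt.sum (f := fun (i : F) z => c i * (ρ i ((chartAt ℂ x).symm z) *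
    g x i ((chartAt ℂ x).symm z))) fun i _ =>
      contDiffAt_const.mul (h.contDiffAt_mul_transition (hρ i) (hρs i) hq)

theorem IsLogLineData.combination_eq_mul (h : IsLogLineData S U g a)
    (hρs : ∀ x, tsupport (ρ x) ⊆ U x) (c : F → ℂ) {x y q : X} (hq : q ∈ U x ∩ U y) :
    combination F ρ g c x q = g x y q * combination F ρ g c y q := by
  rw [combination, combination, Finset.mul_sum]
  refine Finset.sum_congr rfl fun i _ => ?_
  by_cases hqi : q ∈ tsupport (ρ i)
  · rw [h.cocycle x y i q ⟨hq, hρs i hqi⟩]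
    ring
  · simp [image_eq_zero_of_notMem_tsupport hqi]

/-- A generic combination of truncated local frames has isolated zeros. -/
theorem IsLogLineData.exists_isolated_zeros (h : IsLogLineData S U g a)
    (hρ : ∀ x, IsSmoothFun (ρ x)) (hρs : ∀ x, tsupport (ρ x) ⊆ U x)
    (hρ1 : ∀ q, ∑ x ∈ F, ρ x q = 1) :
    ∃ c : F → ℂ, ∀ q, ∀ᶠ q' in 𝓝[≠] q, combination F ρ g c q' q' ≠ 0 := by
  classical
  set O : X → Set X := fun i => {q | q ∈ U i ∧ ρ i q ≠ 0} with hO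
  have hOU : ∀ i, O i ⊆ (chartAt ℂ i).source := fun i q hq => h.subset i hq.1
  have hq_sm : ∀ i, ∀ q ∈ O i, ∀ j : X, DifferentiableAt ℝ
      ((fun q => (ρ j q * g i j q) / ρ i q) ∘ (chartAt ℂ i).symm) (chartAt ℂ i q) := by
    intro i q hq j
    simp only [div_eq_mul_inv]
    refine ((h.contDiffAt_mul_transition (hρ j) (hρs j) hq.1).mul
      ((((hρ i).contDiffAt (hOU i hq)).of_le (WithTop.coe_le_coe.2 (le_top (a := (2 : ℕ∞))))).inv ?_)).differentiableAt (by norm_num)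
    simpa [(chartAt ℂ i).left_inv (hOU i hq)] using hq.2
  have hae : ∀ᵐ c : F → ℂ, ∀ i : F, ∀ z ∈ chartAt ℂ (i : X) '' O i,
      c i + ∑ j ∈ Finset.univ.erase i, c j *
        ((fun q => (ρ j q * g i j q) / ρ i q) ∘ (chartAt ℂ (i : X)).symm) z = 0 →
      Function.Injective (fderiv ℝ (fun z => ∑ j ∈ Finset.univ.erase i, c j *
        ((fun q => (ρ j q * g i j q) / ρ i q) ∘ (chartAt ℂ (i : X)).symm) z) z) := by
    rw [ae_all_iff]
    intro i
    refine ae_injective_fderiv i _ _ ?_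
    rintro j _ ⟨q, hq, rfl⟩
    exact hq_sm i q hq j
  obtain ⟨c, hc⟩ := hae.exists
  refine ⟨c, fun q => ?_⟩
  obtain ⟨i, hi⟩ : ∃ i : F, ρ i q ≠ 0 := by
    by_contra! hall
    have := hρ1 q
    rw [Finset.sum_eq_zero fun x hx => hall ⟨x, hx⟩] at this
    exact zero_ne_one this
  have hqO : q ∈ O i := ⟨hρs i (subset_tsupport _ hi), hi⟩
  have hsrc := hOU i hqO
  set ψ : ℂ → ℂ := fun z => ∑ j ∈ Finset.univ.erase i, c j *
        ((fun q => (ρ j q * g i j q) / ρ i q) ∘ (chartAt ℂ (i : X)).symm) z with hψ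
  -- Where ρ_i is nonzero, dividing by it makes the i-th term the constant c_i. This is the form
  -- required by the Sard argument.
  have hcomb : ∀ q' ∈ O i, combination F ρ g c i q' =
      ρ i q' * (c i + ψ (chartAt ℂ (i : X) q')) := by
    intro q' hq'
    rw [combination, ← Finset.add_sum_erase _ _ (Finset.mem_univ i),
      h.transition_self hq'.1, mul_add, hψ, Finset.mul_sum]
    simp only [Function.comp_apply, (chartAt ℂ (i : X)).left_inv (hOU i hq')]
    congr 1
    · ring
    · refine Finset.sum_congr rfl fun j _ => ?_
      have := hq'.2
      field_simp
  have hψd : DifferentiableAt ℝ ψ (chartAt ℂ (i : X) q) :=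
    DifferentiableAt.fun_sum fun j _ => (hq_sm i q hqO j).const_mul (c j)
  have hev : ∀ᶠ z in 𝓝[≠] (chartAt ℂ (i : X) q), ψ z ≠ -c i := by
    -- At a zero, genericity of c gives an injective derivative; away from the zeros continuity
    -- suffices.
    by_cases h0 : c i + ψ (chartAt ℂ (i : X) q) = 0
    · exact eventually_ne_of_injective hψd (hc i _ ⟨q, hqO, rfl⟩ h0) _
    · have hne : ψ (chartAt ℂ (i : X) q) ≠ -c i := fun he => h0 (by rw [he, add_neg_cancel])
      exact (hψd.continuousAt.eventually_ne hne).filter_mono nhdsWithin_le_nhds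
  have hρc : ∀ᶠ q' in 𝓝 q, ρ i q' ≠ 0 := by
    have h0 : (ρ i ∘ (chartAt ℂ (i : X)).symm) (chartAt ℂ (i : X) q) ≠ 0 := by
      simpa [(chartAt ℂ (i : X)).left_inv hsrc] using hi
    have h1 := ((hρ i).differentiableAt hsrc).continuousAt.eventually_ne h0
    filter_upwards [(chartAt ℂ (i : X)).continuousAt hsrc h1,
      (chartAt ℂ (i : X)).open_source.mem_nhds hsrc] with q' hq' hs
    simpa [(chartAt ℂ (i : X)).left_inv hs] using hq'
  filter_upwards [tendsto_chart_nhdsNE hsrc hev, nhdsWithin_le_nhds hρc,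
    nhdsWithin_le_nhds ((h.isOpen i).mem_nhds hqO.1)] with q' h1 h2 h3
  rw [h.combination_eq_mul hρs c ⟨h.mem q', h3⟩, hcomb q' ⟨h3, h2⟩]
  refine mul_ne_zero (h.ne_zero _ _ _ ⟨h.mem q', h3⟩) (mul_ne_zero h2 fun he => h1 ?_)
  exact eq_neg_of_add_eq_zero_right he

/-- The residues of a logarithmic connection on a line bundle add up to an integer. -/
theorem IsLogLineData.exists_sum_eq_intCast [T2Space X] [CompactSpace X]
    [IsManifold 𝓘(ℂ, ℂ) ω X] (h : IsLogLineData S U g a) :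
    ∃ k : ℤ, ∑ p ∈ S, a p (chartAt ℂ p p) = k := by
  classical
  obtain ⟨F, ρ, hρ, hρs, hρ1⟩ := exists_partitionOfUnity h.isOpen h.mem
  obtain ⟨c, hc⟩ := h.exists_isolated_zeros hρ hρs hρ1
  have hfin : {q | combination F ρ g c q q = 0}.Finite := finite_of_eventually_notMem hc
  set T : Finset X := S ∪ hfin.toFinset with hT
  have hnT : ∀ q ∉ T, combination F ρ g c q q ≠ 0 := fun q hq h0 =>
    hq (Finset.mem_union_right _ (hfin.mem_toFinset.2 h0))
  have hne : ∀ x, ∀ q ∈ U x, q ∉ T → combination F ρ g c x q ≠ 0 := fun x q hx hq => by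
    rw [h.combination_eq_mul hρs c ⟨hx, h.mem q⟩]
    exact mul_ne_zero (h.ne_zero _ _ _ ⟨hx, h.mem q⟩) (hnT q hq)
  have hsec : IsSmoothSection T U g (combination F ρ g c) :=
    ⟨fun x q hx _ => h.contDiffAt_combination hρ hρs c hx, hne,
      fun x y q hq _ => h.combination_eq_mul hρs c hq⟩
  -- The integer is the winding number of the smooth section around p; its value is irrelevant.
  have hN : ∀ p ∈ T, ∃ N : ℤ, ∃ R > 0, ∀ r ∈ Ioo 0 R,
      circInt (dlog (combination F ρ g c p ∘ (chartAt ℂ p).symm)) (chartAt ℂ p p) r =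
        2 * Real.pi * I * N := by
    intro p _
    have hopen : IsOpen (U p \ (T \ {p} : Set X)) :=
      (h.isOpen p).sdiff (T.finite_toSet.sdiff (t := {p})).isClosed
    obtain ⟨R, hR, hb⟩ := Metric.isOpen_iff.1 (isOpen_chart_image hopen
      (sdiff_subset.trans (h.subset p))) (chartAt ℂ p p) ⟨p, ⟨h.mem p, fun hp => hp.2 rfl⟩, rfl⟩
    obtain ⟨k, hk⟩ := exists_int_circInt_dlog (p := chartAt ℂ p p) (R := R)
      (f := combination F ρ g c p ∘ (chartAt ℂ p).symm) (by
        rintro z ⟨hz, -⟩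
        obtain ⟨q, hq, rfl⟩ := hb hz
        exact ((h.contDiffAt_combination hρ hρs c hq.1).of_le (by norm_num)).contDiffWithinAt)
      (by
        rintro z ⟨hz, hzp⟩
        obtain ⟨q, hq, rfl⟩ := hb hz
        rw [Function.comp_apply, (chartAt ℂ p).left_inv (h.subset p hq.1)]
        refine hne p q hq.1 fun hqT => hq.2 ⟨hqT, fun hqp => hzp ?_⟩
        rw [mem_singleton_iff] at hqp ⊢
        rw [hqp])
    exact ⟨k, R, hR, fun r hr => by rw [hk r hr]; ring⟩
  choose! N hN using hN
  have key := h.sum_residue Finset.subset_union_left hsec (fun p => (N p : ℂ)) hN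
  exact ⟨-∑ p ∈ T, N p, by push_cast; linear_combination key⟩

/-- The logarithmic differential is (m / (z - c) + u' / u) dz with u' / u holomorphic near c, so
Cauchy's formula leaves 2πi m. -/
theorem circInt_dlog_of_eq_zpow_mul {G u : ℂ → ℂ} {c : ℂ} {m : ℤ} (hu : AnalyticAt ℂ u c)
    (hu0 : u c ≠ 0) (hG : ∀ᶠ z in 𝓝[≠] c, G z = (z - c) ^ m • u z) :
    ∃ R > 0, ∀ r ∈ Ioo 0 R, circInt (dlog G) c r = 2 * Real.pi * I * m := by
  obtain ⟨R₁, hR₁, h₁⟩ := Metric.mem_nhdsWithin_iff.1 hG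
  obtain ⟨R₂, hR₂, h₂⟩ := Metric.mem_nhds_iff.1
    (hu.eventually_analyticAt.and (hu.continuousAt.eventually_ne hu0))
  set R := min R₁ R₂ with hR
  have hGR : ∀ z ∈ pball c R, G z = (z - c) ^ m * u z := fun z hz =>
    h₁ ⟨Metric.ball_subset_ball (min_le_left _ _) hz.1, hz.2⟩
  have huR : ∀ z ∈ Metric.ball c R, AnalyticAt ℂ u z ∧ u z ≠ 0 := fun z hz =>
    h₂ (Metric.ball_subset_ball (min_le_right _ _) hz)
  have hdlog : ∀ z ∈ pball c R,
      dlog G z = mulReal ((z - c)⁻¹ * (m + (z - c) * (deriv u z / u z))) := by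
    intro z hz
    have hzc : z - c ≠ 0 := sub_ne_zero.2 hz.2
    have hev : G =ᶠ[𝓝 z] fun z => (z - c) ^ m * u z := by
      filter_upwards [(isOpen_pball c R).mem_nhds hz] with w hw using hGR w hw
    have hd : HasDerivAt (fun z => (z - c) ^ m * u z)
        (m * (z - c) ^ (m - 1) * u z + (z - c) ^ m * deriv u z) z := by
      have h3 : HasDerivAt (fun z => (z - c) ^ m) (m * (z - c) ^ (m - 1)) z := by
        have := (hasDerivAt_zpow m (z - c) (Or.inl hzc)).comp z ((hasDerivAt_id z).sub_const c)
        simpa using! this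
      exact h3.mul (huR z hz.1).1.differentiableAt.hasDerivAt
    have hf := (hasFDerivAt_mulReal hd.differentiableAt).fderiv
    rw [dlog, hev.fderiv_eq, hf, hd.deriv, hev.self_of_nhds]
    refine ContinuousLinearMap.ext fun v => ?_
    have h4 := (huR z hz.1).2
    have h5 : (z - c) ^ m ≠ 0 := zpow_ne_zero m hzc
    simp only [smul_apply, mulReal_apply, smul_eq_mul, zpow_sub_one₀ hzc]
    field_simp
  refine ⟨R, lt_min hR₁ hR₂, fun r hr => ?_⟩
  rw [circInt_congr hr hdlog, circInt_mulReal_inv_mul hr]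
  · simp
  · intro z hz
    refine DifferentiableAt.differentiableWithinAt ?_
    exact (differentiableAt_const _).add ((differentiableAt_id.sub_const _).mul
      ((huR z hz).1.deriv.differentiableAt.div (huR z hz).1.differentiableAt (huR z hz).2))

/-- The order of a meromorphic section of a line bundle with a logarithmic connection plus the sum
of the residues of the connection is zero. -/
theorem IsLogLineData.finsum_order_add_sum [T2Space X] [CompactSpace X]
    [IsManifold 𝓘(ℂ, ℂ) ω X] (h : IsLogLineData S U g a) {f : X → X → ℂ}
    (hf : ∀ x y, ∀ q ∈ U x ∩ U y, f x q = g x y q * f y q)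
    (hm : ∀ x, MeromorphicAt (f x ∘ (chartAt ℂ x).symm) (chartAt ℂ x x))
    (ht : ∀ x, meromorphicOrderAt (f x ∘ (chartAt ℂ x).symm) (chartAt ℂ x x) ≠ ⊤) :
    ((∑ᶠ x, (meromorphicOrderAt (f x ∘ (chartAt ℂ x).symm) (chartAt ℂ x x)).untop₀ : ℤ) : ℂ) +
      ∑ p ∈ S, a p (chartAt ℂ p p) = 0 := by
  classical
  set N : X → ℤ := fun x =>
    (meromorphicOrderAt (f x ∘ (chartAt ℂ x).symm) (chartAt ℂ x x)).untop₀ with hN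
  have hloc : ∀ x, ∃ u : ℂ → ℂ, AnalyticAt ℂ u (chartAt ℂ x x) ∧ u (chartAt ℂ x x) ≠ 0 ∧
      ∀ᶠ z in 𝓝[≠] (chartAt ℂ x x),
        (f x ∘ (chartAt ℂ x).symm) z = (z - chartAt ℂ x x) ^ N x • u z := fun x =>
    (meromorphicOrderAt_eq_int_iff (hm x)).1 (WithTop.coe_untop₀_of_ne_top (ht x)).symm
  set A : Set X := {x | ¬ (AnalyticAt ℂ (f x ∘ (chartAt ℂ x).symm) (chartAt ℂ x x) ∧ f x x ≠ 0)}
    with hA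
  -- Being analytic and nonzero at q does not depend on the chart and frame. This allows passage
  -- between the frame around x and the frame around q itself, in which the order at q is measured.
  have hmove : ∀ x, ∀ q ∈ U x, AnalyticAt ℂ (f x ∘ (chartAt ℂ x).symm) (chartAt ℂ x q) →
      f x q ≠ 0 → ∀ y, q ∈ U y →
      AnalyticAt ℂ (f y ∘ (chartAt ℂ y).symm) (chartAt ℂ y q) ∧ f y q ≠ 0 := by
    intro x q hx han hne y hy
    have hsx := h.subset x hx
    have hsy := h.subset y hy
    constructor
    · have hg : AnalyticAt ℂ (g y x ∘ (chartAt ℂ y).symm) (chartAt ℂ y q) := by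
        have hopen := isOpen_chart_image ((h.isOpen y).inter (h.isOpen x))
          (inter_subset_left.trans (h.subset y))
        exact (h.differentiableOn_transition y x).analyticAt (hopen.mem_nhds ⟨q, ⟨hy, hx⟩, rfl⟩)
      have htr : AnalyticAt ℂ (trans y x) (chartAt ℂ y q) := by
        refine Complex.analyticAt_iff_eventually_differentiableAt.2 ?_
        filter_upwards [eventually_symm_mem (chartAt ℂ x).open_source hsy hsx] with z hz
        have := differentiableAt_trans (x := y) (y := x) ((chartAt ℂ y).map_target hz.1) hz.2
        rwa [(chartAt ℂ y).right_inv hz.1] at this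
      rw [← trans_apply (y := x) hsy] at han
      refine (hg.mul (han.comp htr)).congr ?_
      filter_upwards [comp_symm_eventuallyEq (f x) hsy hsx,
        eventually_symm_mem ((h.isOpen y).inter (h.isOpen x)) hsy ⟨hy, hx⟩] with z hz hz2
      have h1 := hf y x _ hz2.2
      simp only [Function.comp_apply] at hz ⊢
      rw [h1]
      simp only [Pi.mul_apply, Function.comp_apply]
      rw [← hz]
    · rw [hf y x q ⟨hy, hx⟩]
      exact mul_ne_zero (h.ne_zero _ _ _ ⟨hy, hx⟩) hne
  have hAfin : A.Finite := by
    refine finite_of_eventually_notMem fun x => ?_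
    obtain ⟨u, hu, hu0, hev⟩ := hloc x
    have h1 : ∀ᶠ z in 𝓝[≠] (chartAt ℂ x x), AnalyticAt ℂ (f x ∘ (chartAt ℂ x).symm) z ∧
        (f x ∘ (chartAt ℂ x).symm) z ≠ 0 := by
      have hu1 := nhdsWithin_le_nhds (s := {chartAt ℂ x x}ᶜ) hu.eventually_analyticAt
      have hu2 := nhdsWithin_le_nhds (s := {chartAt ℂ x x}ᶜ)
        (hu.continuousAt.eventually_ne hu0)
      filter_upwards [(hm x).eventually_analyticAt, hev, hu2, self_mem_nhdsWithin]
        with z hz1 hz2 hz3 hz4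
      refine ⟨hz1, ?_⟩
      rw [hz2]
      exact mul_ne_zero (zpow_ne_zero _ (sub_ne_zero.2 hz4)) hz3
    filter_upwards [tendsto_chart_nhdsNE (mem_chart_source ℂ x) h1,
      nhdsWithin_le_nhds ((h.isOpen x).mem_nhds (h.mem x))] with q hq hqU
    rw [mem_preimage, mem_ofPred_eq, Function.comp_apply,
      (chartAt ℂ x).left_inv (h.subset x hqU)] at hq
    exact fun hqA => hqA (hmove x q hqU hq.1 hq.2 q (h.mem q))
  set T : Finset X := S ∪ hAfin.toFinset with hT
  have hnA : ∀ q ∉ T, AnalyticAt ℂ (f q ∘ (chartAt ℂ q).symm) (chartAt ℂ q q) ∧ f q q ≠ 0 :=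
    fun q hq => by_contra fun h0 => hq (Finset.mem_union_right _ (hAfin.mem_toFinset.2 h0))
  have hsec : IsSmoothSection T U g f := by
    refine ⟨fun x q hx hq => ?_, fun x q hx hq => ?_, fun x y q hq _ => hf x y q hq⟩
    · exact (hmove q q (h.mem q) (hnA q hq).1 (hnA q hq).2 x hx).1.contDiffAt.restrict_scalars ℝ
    · exact (hmove q q (h.mem q) (hnA q hq).1 (hnA q hq).2 x hx).2
  have key := h.sum_residue Finset.subset_union_left hsec (fun p => (N p : ℂ)) fun p _ => by
    obtain ⟨u, hu, hu0, hev⟩ := hloc p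
    exact circInt_dlog_of_eq_zpow_mul hu hu0 hev
  -- Off `T` the section is analytic and nonzero in its own chart, so its order there is 0.
  have hsum : ∑ᶠ x, N x = ∑ p ∈ T, N p := by
    refine finsum_eq_sum_of_support_subset _ fun x hx => ?_
    by_contra hxT
    refine hx ?_
    have h1 := hnA x hxT
    have h2 : (f x ∘ (chartAt ℂ x).symm) (chartAt ℂ x x) ≠ 0 := by
      simpa using h1.2
    simp only [hN]
    rw [h1.1.meromorphicOrderAt_eq, analyticOrderAt_eq_zero.2 (Or.inr h2)]
    simp
  rw [hsum]
  push_cast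
  exact key

end LineData

/-! ### Linear algebra of determinants and traces. -/

section Determinant

variable {r : ℕ}

theorem contDiff_det (m : ℕ∞ω) :
    ContDiff ℂ m fun A : Fin r → Fin r → ℂ => (Matrix.of A).det := by
  simp only [Matrix.det_apply, Matrix.of_apply]
  refine ContDiff.sum fun σ _ => ContDiff.const_smul _ (contDiff_prod fun i _ => ?_)
  fun_prop

/-- Jacobi's formula for the derivative of a determinant. -/
theorem hasDerivAt_det {M : ℂ → Matrix (Fin r) (Fin r) ℂ} {M' : Matrix (Fin r) (Fin r) ℂ} {z : ℂ}
    (h : ∀ i j, HasDerivAt (fun w => M w i j) (M' i j) z) :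
    HasDerivAt (fun w => (M w).det) ((M z).adjugate * M').trace z := by
  let f : ContinuousMultilinearMap ℂ (fun _ : Fin r => Fin r → ℂ) ℂ :=
    { Matrix.detRowAlternating.toMultilinearMap with
      cont := Continuous.matrix_det continuous_id }
  have h1 : HasDerivAt (fun w => (M w : Fin r → Fin r → ℂ)) M' z :=
    hasDerivAt_pi.2 fun i => hasDerivAt_pi.2 fun j => h i j
  have h2 := (f.hasFDerivAt (M z)).comp_hasDerivAt z h1
  refine h2.congr_deriv ?_
  refine (f.linearDeriv_apply (fun i j => M z i j) (fun i j => M' i j)).trans ?_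
  rw [Matrix.trace_mul_comm]
  refine Finset.sum_congr rfl fun i _ => ?_
  have h3 : f (Function.update (fun i j => M z i j) i (M' i)) =
      ((M z).updateRow i (M' i)).det := rfl
  refine h3.trans ?_
  rw [← Matrix.cramer_transpose_apply, Matrix.cramer_eq_adjugate_mulVec,
    ← Matrix.adjugate_transpose]
  simp [Matrix.mulVec, dotProduct, Matrix.mul_apply, mul_comm]

/-- The trace identity behind the transformation of connection forms of determinants. -/
theorem trace_gauge {G A B M' : Matrix (Fin r) (Fin r) ℂ} {κ μ : ℂ} (hG : G.det ≠ 0)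
    (h : κ • (G * A) = μ • (B * G) + M') :
    κ * A.trace = μ * B.trace + (G.adjugate * M').trace / G.det := by
  -- Multiplying by the adjugate and taking traces turns conjugation by G into the scalar factor det
  -- G.
  have h1 := congrArg (fun N => (G.adjugate * N).trace) h
  simp only [Matrix.mul_add, Matrix.mul_smul, Matrix.trace_add, Matrix.trace_smul,
    smul_eq_mul] at h1
  rw [← Matrix.mul_assoc, Matrix.adjugate_mul, ← Matrix.trace_mul_comm (B * G),
    Matrix.mul_assoc, Matrix.mul_adjugate] at h1
  simp only [Matrix.smul_mul, Matrix.mul_smul, Matrix.one_mul, Matrix.mul_one, Matrix.trace_smul,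
    smul_eq_mul] at h1
  field_simp
  linear_combination h1

/-- Linear maps out of the exterior power are determined on decomposable elements, where the claim
is multiplicativity of the determinant. -/
theorem det_exteriorPower_map (L : (Fin r → ℂ) →ₗ[ℂ] (Fin r → ℂ)) (w : ⋀[ℂ]^r (Fin r → ℂ)) :
    exteriorPower.alternatingMapLinearEquiv (Matrix.detRowAlternating (n := Fin r) (R := ℂ))
      (exteriorPower.map r L w) = (LinearMap.toMatrix' L).det *
    exteriorPower.alternatingMapLinearEquiv (Matrix.detRowAlternating (n := Fin r) (R := ℂ)) w := by
  have h : (exteriorPower.alternatingMapLinearEquiv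
      (Matrix.detRowAlternating (n := Fin r) (R := ℂ))).comp (exteriorPower.map r L) =
      (LinearMap.toMatrix' L).det • exteriorPower.alternatingMapLinearEquiv
        (Matrix.detRowAlternating (n := Fin r) (R := ℂ)) := by
    refine exteriorPower.linearMap_ext (AlternatingMap.ext fun m => ?_)
    simp only [LinearMap.compAlternatingMap_apply, LinearMap.comp_apply,
      exteriorPower.map_apply_ιMulti, exteriorPower.alternatingMapLinearEquiv_apply_ιMulti,
      LinearMap.smul_apply, smul_eq_mul]
    have : (fun i => L (m i)) = (Matrix.of m) * (LinearMap.toMatrix' L).transpose := by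
      funext i
      conv_lhs => rw [← LinearMap.toMatrix'_mulVec L (m i)]
      funext j
      simp [Matrix.mul_apply, Matrix.mulVec, dotProduct, mul_comm]
    change Matrix.det (fun i => L (m i)) = _ * Matrix.det (Matrix.of m)
    rw [this, Matrix.det_mul, Matrix.det_transpose, mul_comm]
  exact congrArg (fun f => f w) h

end Determinant

/-! ### Differentials evaluated on coordinate vectors. -/

section Differential

variable {X : Type*} [TopologicalSpace X] [ChartedSpace ℂ X]

theorem differentiableAt_comp_symm [IsManifold 𝓘(ℂ, ℂ) ω X] {f : X → ℂ} {V : Set X} (hV : IsOpen V)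
    (hf : ContMDiffOn 𝓘(ℂ, ℂ) 𝓘(ℂ, ℂ) ω f V) {x q : X} (hq : q ∈ V)
    (hx : q ∈ (chartAt ℂ x).source) :
    DifferentiableAt ℂ (f ∘ (chartAt ℂ x).symm) (chartAt ℂ x q) := by
  have h1 : ContMDiffAt 𝓘(ℂ, ℂ) 𝓘(ℂ, ℂ) ω (chartAt ℂ x).symm (chartAt ℂ x q) :=
    (contMDiffOn_chart_symm (I := 𝓘(ℂ, ℂ)) (x := x)).contMDiffAt
      ((chartAt ℂ x).open_target.mem_nhds ((chartAt ℂ x).map_source hx))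
  have h2 : ContMDiffAt 𝓘(ℂ, ℂ) 𝓘(ℂ, ℂ) ω f ((chartAt ℂ x).symm (chartAt ℂ x q)) := by
    rw [(chartAt ℂ x).left_inv hx]
    exact hf.contMDiffAt (hV.mem_nhds hq)
  exact (contMDiffAt_iff_contDiffAt.1 (h2.comp _ h1)).differentiableAt (by simp)

/-- The coordinate vector at `q` of the chart around `x`. -/
def coordVec (x q : X) : TangentSpace 𝓘(ℂ, ℂ) q := (deriv (trans x q) (chartAt ℂ x q) : ℂ)

theorem mfderiv_eq_fderiv {f : X → ℂ} {q : X} (hm : MDifferentiableAt 𝓘(ℂ, ℂ) 𝓘(ℂ, ℂ) f q) :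
    (mfderiv 𝓘(ℂ, ℂ) 𝓘(ℂ, ℂ) f q : ℂ →L[ℂ] ℂ) =
      fderiv ℂ (f ∘ (chartAt ℂ q).symm) (chartAt ℂ q q) := by
  refine Eq.trans hm.mfderiv ?_
  simp [writtenInExtChartAt, fderivWithin_univ, Function.comp_def, chartAt_self_eq]
  rfl

/-- The differential at q is computed in the preferred chart at q. The coordinate vector carries the
Jacobian needed to convert it to a derivative in the chart around x. -/
theorem diff_apply [IsManifold 𝓘(ℂ, ℂ) ω X] {f : X → ℂ} {V : Set X} (hV : IsOpen V)
    (hf : ContMDiffOn 𝓘(ℂ, ℂ) 𝓘(ℂ, ℂ) ω f V) {x q : X} (hq : q ∈ V)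
    (hx : q ∈ (chartAt ℂ x).source) :
    diff f q (coordVec x q) =
      deriv (f ∘ (chartAt ℂ x).symm) (chartAt ℂ x q) := by
  have hqs := mem_chart_source ℂ q
  have hm : MDifferentiableAt 𝓘(ℂ, ℂ) 𝓘(ℂ, ℂ) f q :=
    (hf.contMDiffAt (hV.mem_nhds hq)).mdifferentiableAt (by simp)
  have h1 : diff f q (coordVec x q) = deriv (f ∘ (chartAt ℂ q).symm) (chartAt ℂ q q) *
      deriv (trans x q) (chartAt ℂ x q) := by
    have h2 := congrArg (fun L : ℂ →L[ℂ] ℂ => L (deriv (trans x q) (chartAt ℂ x q)))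
      (mfderiv_eq_fderiv hm)
    refine Eq.trans h2 ?_
    rw [fderiv_eq_smul_deriv, smul_eq_mul, mul_comm]
  have h3 := differentiableAt_comp_symm hV hf hq hqs
  rw [h1, (comp_symm_eventuallyEq f hx hqs).deriv_eq]
  rw [← trans_apply (y := q) hx] at h3 ⊢
  exact (deriv_comp _ h3 (differentiableAt_trans hx hqs)).symm

theorem logGen_apply [IsManifold 𝓘(ℂ, ℂ) ω X] (S : Finset X) {x y q : X} (hx : q ∈ (chartAt ℂ x).source)
    (hy : q ∈ (chartAt ℂ y).source) :
    logGen S y q (coordVec x q) =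
      pole S y (chartAt ℂ y q) * deriv (trans x y) (chartAt ℂ x q) := by
  have h1 := diff_apply (chartAt ℂ y).open_source
    (contMDiffOn_chart (I := 𝓘(ℂ, ℂ)) (x := y)) hy hx
  unfold logGen pole
  split_ifs
  · refine (LinearMap.smul_apply _ _ _).trans ?_
    rw [smul_eq_mul, h1, trans]
  · rw [one_mul]
    exact h1

theorem deriv_trans_self {x q : X} (hx : q ∈ (chartAt ℂ x).source) :
    deriv (trans x x) (chartAt ℂ x q) = 1 := by
  have : trans x x =ᶠ[𝓝 (chartAt ℂ x q)] id := by
    filter_upwards [(chartAt ℂ x).open_target.mem_nhds ((chartAt ℂ x).map_source hx)] with z hz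
    simp [trans, (chartAt ℂ x).right_inv hz]
  rw [this.deriv_eq, deriv_id]

end Differential

/-! ### Holomorphic frames of subbundles and their coordinate maps. -/

section Frames

variable {X : Type*} [TopologicalSpace X] [ChartedSpace ℂ X] {n : ℕ} {E : X → Type*}
  [∀ x, AddCommGroup (E x)] [∀ x, Module ℂ (E x)] [∀ x, TopologicalSpace (E x)]
  [TopologicalSpace (TotalSpace (Fin n → ℂ) E)] [FiberBundle (Fin n → ℂ) E]

/-- `s` is a holomorphic frame of the subbundle `W` over the open set `U`. -/
structure IsFrameOn (n : ℕ) {E : X → Type*}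
    [∀ x, AddCommGroup (E x)] [∀ x, Module ℂ (E x)] [∀ x, TopologicalSpace (E x)]
    [TopologicalSpace (TotalSpace (Fin n → ℂ) E)] [FiberBundle (Fin n → ℂ) E]
    (W : ∀ x, Submodule ℂ (E x)) {r : ℕ} (U : Set X) (s : Fin r → ∀ y, E y) : Prop where
  isOpen : IsOpen U
  isHolSection : ∀ i, IsHolSection n U (s i)
  linearIndependent : ∀ y ∈ U, LinearIndependent ℂ fun i => s i y
  span_eq : ∀ y ∈ U, Submodule.span ℂ (range fun i => s i y) = W y

/-- `c` is a holomorphic family of coordinate maps for the frame `s` over `U`. -/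
structure IsCoframeOn (n : ℕ) {E : X → Type*}
    [∀ x, AddCommGroup (E x)] [∀ x, Module ℂ (E x)] [∀ x, TopologicalSpace (E x)]
    [TopologicalSpace (TotalSpace (Fin n → ℂ) E)] [FiberBundle (Fin n → ℂ) E]
    {r : ℕ} (U : Set X) (s : Fin r → ∀ y, E y) (c : ∀ y, E y →ₗ[ℂ] (Fin r → ℂ)) : Prop where
  apply_frame : ∀ y ∈ U, ∀ i, c y (s i y) = Pi.single i 1
  contMDiffOn : ∀ (V : Set X) (σ : ∀ y, E y), IsOpen V → V ⊆ U → IsHolSection n V σ →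
    ∀ i, ContMDiffOn 𝓘(ℂ, ℂ) 𝓘(ℂ, ℂ) ω (fun y => c y (σ y) i) V

theorem IsFrameOn.mono {W : ∀ x, Submodule ℂ (E x)} {r : ℕ} {U V : Set X}
    {s : Fin r → ∀ y, E y} (h : IsFrameOn n W U s) (hV : IsOpen V) (hVU : V ⊆ U) :
    IsFrameOn n W V s :=
  ⟨hV, fun i => (h.isHolSection i).mono hVU, fun y hy => h.linearIndependent y (hVU hy),
    fun y hy => h.span_eq y (hVU hy)⟩

theorem IsCoframeOn.mono {r : ℕ} {U V : Set X} {s : Fin r → ∀ y, E y}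
    {c : ∀ y, E y →ₗ[ℂ] (Fin r → ℂ)} (h : IsCoframeOn n U s c) (hVU : V ⊆ U) :
    IsCoframeOn n V s c :=
  ⟨fun y hy => h.apply_frame y (hVU hy), fun V' σ hV' hV'V => h.contMDiffOn V' σ hV' (hV'V.trans hVU)⟩

theorem IsFrameOn.mem {W : ∀ x, Submodule ℂ (E x)} {r : ℕ} {U : Set X}
    {s : Fin r → ∀ y, E y} (h : IsFrameOn n W U s) {y : X} (hy : y ∈ U) (i : Fin r) :
    s i y ∈ W y := by
  rw [← h.span_eq y hy]
  exact Submodule.subset_span ⟨i, rfl⟩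

theorem IsFrameOn.eq_sum {W : ∀ x, Submodule ℂ (E x)} {r : ℕ} {U : Set X}
    {s : Fin r → ∀ y, E y} (h : IsFrameOn n W U s) {c : ∀ y, E y →ₗ[ℂ] (Fin r → ℂ)}
    (hc : IsCoframeOn n U s c) {y : X} (hy : y ∈ U) {e : E y} (he : e ∈ W y) :
    e = ∑ i, c y e i • s i y := by
  rw [← h.span_eq y hy] at he
  obtain ⟨b, rfl⟩ := (Submodule.mem_span_range_iff_exists_fun ℂ).1 he
  refine Finset.sum_congr rfl fun i _ => ?_
  simp only [map_sum, map_smul, hc.apply_frame y hy]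
  simp [Finset.sum_apply, Pi.single_apply]

theorem contMDiffOn_det {r : ℕ} {V : Set X} {A : X → Fin r → Fin r → ℂ}
    (h : ∀ i j, ContMDiffOn 𝓘(ℂ, ℂ) 𝓘(ℂ, ℂ) ω (fun y => A y i j) V) :
    ContMDiffOn 𝓘(ℂ, ℂ) 𝓘(ℂ, ℂ) ω (fun y => (Matrix.of (A y)).det) V :=
  (contDiff_det ω).contMDiff.comp_contMDiffOn
    (contMDiffOn_pi_space.2 fun i => contMDiffOn_pi_space.2 fun j => h i j)

variable [VectorBundle ℂ (Fin n → ℂ) E] [ContMDiffVectorBundle ω (Fin n → ℂ) E 𝓘(ℂ, ℂ)]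

theorem contMDiffOn_linearMapAt {V : Set X} {σ : ∀ y, E y} (hV : IsOpen V) {x : X}
    (hVx : V ⊆ (trivializationAt (Fin n → ℂ) E x).baseSet) (hσ : IsHolSection n V σ) :
    ContMDiffOn 𝓘(ℂ, ℂ) 𝓘(ℂ, Fin n → ℂ) ω
      (fun y => (trivializationAt (Fin n → ℂ) E x).linearMapAt ℂ y (σ y)) V := by
  refine ((trivializationAt (Fin n → ℂ) E x).contMDiffOn_section_iff hV hVx |>.1 hσ).congr
    fun y hy => ?_
  rw [Trivialization.coe_linearMapAt_of_mem _ (hVx hy)]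

/-- A holomorphic frame of a subbundle has a holomorphic family of coordinate maps. -/
theorem IsFrameOn.exists_coframe [IsManifold 𝓘(ℂ, ℂ) ω X] {W : ∀ x, Submodule ℂ (E x)} {r : ℕ}
    {U : Set X} {s : Fin r → ∀ y, E y} (h : IsFrameOn n W U s) {x : X} (hx : x ∈ U) :
    ∃ (V : Set X) (c : ∀ y, E y →ₗ[ℂ] (Fin r → ℂ)), IsOpen V ∧ x ∈ V ∧ V ⊆ U ∧
      IsCoframeOn n V s c := by
  set e := trivializationAt (Fin n → ℂ) E x with he
  have hxe : x ∈ e.baseSet := mem_baseSet_trivializationAt _ _ _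
  have hli : LinearIndependent ℂ fun i => e.linearMapAt ℂ x (s i x) := by
    refine (h.linearIndependent x hx).map' (e.linearMapAt ℂ x) (LinearMap.ker_eq_bot.2 ?_)
    rw [Trivialization.linearMapAt_def_of_mem e hxe]
    exact (e.linearEquivAt ℂ x hxe).injective
  -- A fixed linear left inverse p at the point x projects the frame to r × r matrices A(y), with
  -- A(x) = 1. Near x these stay invertible, and Cramer's rule gives coordinate maps that are
  -- holomorphic in y.
  obtain ⟨p, hp⟩ := LinearMap.exists_leftInverse_of_injective
    (Fintype.linearCombination ℂ fun i => e.linearMapAt ℂ x (s i x))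
    (LinearMap.ker_eq_bot.2 (linearIndependent_iff_injective_fintypeLinearCombination.1 hli))
  let A : X → Fin r → Fin r → ℂ := fun y i j => p (e.linearMapAt ℂ y (s j y)) i
  have hAx : (Matrix.of (A x)).det = 1 := by
    have : Matrix.of (A x) = 1 := by
      ext i j
      have h1 := congrFun (congrArg (fun L => L (Pi.single j 1)) hp) i
      simp only [LinearMap.comp_apply, Fintype.linearCombination_apply_single, one_smul,
        LinearMap.id_apply] at h1
      simp [A, h1, Matrix.one_apply, Pi.single_apply]
    rw [this, Matrix.det_one]
  have hpc : ContDiff ℂ ω p := p.toContinuousLinearMap.contDiff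
  have hp_hol : ∀ (V : Set X) (σ : ∀ y, E y), IsOpen V → V ⊆ e.baseSet → IsHolSection n V σ →
      ∀ i, ContMDiffOn 𝓘(ℂ, ℂ) 𝓘(ℂ, ℂ) ω (fun y => p (e.linearMapAt ℂ y (σ y)) i) V := by
    intro V σ hV hVe hσ i
    have h1 := hpc.contMDiff.comp_contMDiffOn (contMDiffOn_linearMapAt hV hVe hσ)
    exact contMDiffOn_pi_space.1 h1 i
  have hopen : IsOpen (U ∩ e.baseSet) := h.isOpen.inter e.open_baseSet
  have hdet : ContMDiffOn 𝓘(ℂ, ℂ) 𝓘(ℂ, ℂ) ω (fun y => (Matrix.of (A y)).det) (U ∩ e.baseSet) :=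
    contMDiffOn_det fun i j => hp_hol _ (s j) hopen inter_subset_right
      ((h.isHolSection j).mono inter_subset_left) i
  set V : Set X := (U ∩ e.baseSet) ∩ (fun y => (Matrix.of (A y)).det) ⁻¹' {0}ᶜ with hV
  have hVo : IsOpen V := hdet.continuousOn.isOpen_inter_preimage hopen isOpen_compl_singleton
  refine ⟨V, fun y => ((Matrix.of (A y)).det)⁻¹ •
    ((Matrix.cramer (Matrix.of (A y))).comp (p.comp (e.linearMapAt ℂ y))), hVo,
    ⟨⟨hx, hxe⟩, by simp [hAx]⟩, inter_subset_left.trans inter_subset_left, fun y hy i => ?_,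
    fun V' σ hV' hV'V hσ i => ?_⟩
  · have h1 := Matrix.cramer_transpose_row_self (Matrix.of (A y)).transpose i
    rw [Matrix.transpose_transpose, Matrix.det_transpose] at h1
    have h2 : p (e.linearMapAt ℂ y (s i y)) = (Matrix.of (A y)).transpose i := by
      funext j; rfl
    rw [LinearMap.smul_apply, LinearMap.comp_apply, LinearMap.comp_apply, h2, h1,
      ← Pi.single_smul, smul_eq_mul, inv_mul_cancel₀ hy.2]
  · have hsub : V' ⊆ U ∩ e.baseSet := hV'V.trans inter_subset_left
    have h1 : ContMDiffOn 𝓘(ℂ, ℂ) 𝓘(ℂ, ℂ) ω (fun y => (Matrix.of (fun k l =>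
        if l = i then p (e.linearMapAt ℂ y (σ y)) k else A y k l)).det) V' := by
      refine contMDiffOn_det fun k l => ?_
      split_ifs
      · exact hp_hol V' σ hV' (hsub.trans inter_subset_right) hσ k
      · exact hp_hol V' (s l) hV' (hsub.trans inter_subset_right)
          ((h.isHolSection l).mono (hsub.trans inter_subset_left)) k
    have h2 : ContMDiffOn 𝓘(ℂ, ℂ) 𝓘(ℂ, ℂ) ω (fun y => ((Matrix.of (A y)).det)⁻¹) V' := by
      intro y hy
      have h3 : ContDiffAt ℂ ω (fun z : ℂ => z⁻¹) (Matrix.of (A y)).det :=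
        contDiffAt_inv ℂ (hV'V hy).2
      exact h3.contMDiffAt.comp_contMDiffWithinAt (f := fun y => (Matrix.of (A y)).det) y
        (hdet.mono hsub y hy)
    have h4 : ContMDiffOn 𝓘(ℂ, ℂ) 𝓘(ℂ, ℂ) ω (fun y => ((Matrix.of (A y)).det)⁻¹ •
      (Matrix.of (fun k l =>
        if l = i then p (e.linearMapAt ℂ y (σ y)) k else A y k l)).det) V' := h2.smul h1
    refine h4.congr fun y hy => ?_
    simp only [LinearMap.smul_apply, LinearMap.comp_apply, Pi.smul_apply]
    rw [Matrix.cramer_apply]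
    congr 2
    ext k l
    simp [Matrix.updateCol_apply]

end Frames

/-! ### Connection matrices and the induced connection on the determinant. -/

section Connection

variable {X : Type*} [TopologicalSpace X] [ChartedSpace ℂ X] {n : ℕ} {E : X → Type*}
  [∀ x, AddCommGroup (E x)] [∀ x, Module ℂ (E x)] [∀ x, TopologicalSpace (E x)]
  [TopologicalSpace (TotalSpace (Fin n → ℂ) E)] [FiberBundle (Fin n → ℂ) E]

theorem isHolSection_sum [VectorBundle ℂ (Fin n → ℂ) E] {ι : Type*}
    (F : Finset ι) {V : Set X} {f : ι → X → ℂ}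
    {s : ι → ∀ y, E y} (hf : ∀ i, ContMDiffOn 𝓘(ℂ, ℂ) 𝓘(ℂ, ℂ) ω (f i) V)
    (hs : ∀ i, IsHolSection n V (s i)) :
    IsHolSection n V fun y => ∑ i ∈ F, f i y • s i y :=
  ContMDiffOn.sum_section (t := fun i y => f i y • s i y) fun i _ => (hf i).smul_section (hs i)

theorem LogConnection.D_sum [VectorBundle ℂ (Fin n → ℂ) E]
    {S : Finset X} (D : LogConnection n E S) {ι : Type*} (F : Finset ι)
    {V : Set X} (hV : IsOpen V) {f : ι → X → ℂ} {s : ι → ∀ y, E y}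
    (hf : ∀ i, ContMDiffOn 𝓘(ℂ, ℂ) 𝓘(ℂ, ℂ) ω (f i) V) (hs : ∀ i, IsHolSection n V (s i))
    {q : X} (hq : q ∈ V) (hqS : q ∉ S) :
    D.D (fun y => ∑ i ∈ F, f i y • s i y) q =
      ∑ i ∈ F, (f i q • D.D (s i) q + (diff (f i) q).smulRight (s i q)) := by
  classical
  induction F using Finset.induction_on with
  | empty =>
    have h0 : IsHolSection n V fun y => (0 : E y) := by
      have := isHolSection_sum (E := E) (n := n) (V := V) (∅ : Finset ι) hf hs
      simpa using this
    -- The empty sum is the zero section, which equals 0 times itself.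
    have h1 := D.map_smul V 0 _ hV h0 q hq hqS
    simpa using h1
  | insert i F hi ih =>
    have h1 := D.map_add V (fun y => f i y • s i y) (fun y => ∑ i ∈ F, f i y • s i y) hV
      ((hf i).smul_section (hs i)) (isHolSection_sum F hf hs) q hq hqS
    simp only [Finset.sum_insert hi]
    rw [h1, ih, D.leibniz V (f i) (s i) hV (hf i) (hs i) q hq hqS]

/-- A holomorphic frame of a subbundle preserved by a connection, with its coordinate maps and the
derivatives of its members. -/
structure IsAdaptedFrame {S : Finset X} (D : LogConnection n E S) (W : ∀ x, Submodule ℂ (E x))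
    {r : ℕ} (x : X) (U : Set X) (s g : Fin r → ∀ y, E y) (c : ∀ y, E y →ₗ[ℂ] (Fin r → ℂ)) :
    Prop where
  mem : x ∈ U
  subset : U ⊆ (chartAt ℂ x).source
  isFrameOn : IsFrameOn n W U s
  isCoframeOn : IsCoframeOn n U s c
  isHolSection : ∀ i, IsHolSection n U (g i)
  mem_subbundle : ∀ i, ∀ y ∈ U, g i y ∈ W y
  D_eq : ∀ i, ∀ y ∈ U, y ∉ S → D.D (s i) y = (logGen S x y).smulRight (g i y)

theorem IsFrameOn.exists_adapted [IsManifold 𝓘(ℂ, ℂ) ω X] [VectorBundle ℂ (Fin n → ℂ) E]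
    [ContMDiffVectorBundle ω (Fin n → ℂ) E 𝓘(ℂ, ℂ)] {S : Finset X} {D : LogConnection n E S}
    {W : ∀ x, Submodule ℂ (E x)} (hD : D.Preserves W) {r : ℕ} {U : Set X}
    {s : Fin r → ∀ y, E y} (h : IsFrameOn n W U s) {x : X} (hx : x ∈ U) :
    ∃ (V : Set X) (g : Fin r → ∀ y, E y) (c : ∀ y, E y →ₗ[ℂ] (Fin r → ℂ)), V ⊆ U ∧
      IsAdaptedFrame D W x V s g c := by
  obtain ⟨V₁, c, hV₁, hxV₁, hV₁U, hc⟩ := h.exists_coframe hx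
  have hlog (i : Fin r) := hD U (s i) h.isOpen (h.isHolSection i) (fun y hy => h.mem hy i) x hx
  choose V₂ g hV₂ hxV₂ hg hgW hDg using hlog
  set V : Set X := (V₁ ∩ ⋂ i, V₂ i) ∩ (chartAt ℂ x).source with hV
  have hVo : IsOpen V := (hV₁.inter (isOpen_iInter_of_finite hV₂)).inter
    (chartAt ℂ x).open_source
  have hVV₁ : V ⊆ V₁ := inter_subset_left.trans inter_subset_left
  have hVV₂ : ∀ i, V ⊆ V₂ i := fun i =>
    inter_subset_left.trans (inter_subset_right.trans (iInter_subset _ i))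
  refine ⟨V, g, c, hVV₁.trans hV₁U, ⟨⟨hxV₁, mem_iInter.2 hxV₂⟩, mem_chart_source ℂ x⟩,
    inter_subset_right, h.mono hVo (hVV₁.trans hV₁U),
    hc.mono hVV₁, fun i => (hg i).mono (hVV₂ i), fun i y hy => hgW i y (hVV₂ i hy),
    fun i y hy hyS => hDg i y (hVV₂ i hy) hyS⟩

section LineDataOfFrames

variable {S : Finset X} {D : LogConnection n E S} {W : ∀ x, Submodule ℂ (E x)} {r : ℕ}
  {U : X → Set X} {s g : X → Fin r → ∀ y, E y} {c : X → ∀ y, E y →ₗ[ℂ] (Fin r → ℂ)}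

/-- The matrix of the frame around `y` in terms of the frame around `x`. -/
def frameMatrix (s : X → Fin r → ∀ y, E y) (c : X → ∀ y, E y →ₗ[ℂ] (Fin r → ℂ)) (x y q : X) :
    Matrix (Fin r) (Fin r) ℂ := Matrix.of fun j k => c x q (s y k q) j

theorem frameMatrix_mul (h : ∀ x, IsAdaptedFrame D W x (U x) (s x) (g x) (c x)) {x y z q : X}
    (hy : q ∈ U y) (hz : q ∈ U z) :
    frameMatrix s c x z q = frameMatrix s c x y q * frameMatrix s c y z q := by
  ext j k
  have h1 := (h y).isFrameOn.eq_sum (h y).isCoframeOn hy ((h z).isFrameOn.mem hz k)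
  rw [frameMatrix, Matrix.of_apply, h1]
  simp [frameMatrix, Matrix.mul_apply, mul_comm]

theorem frameMatrix_self (h : ∀ x, IsAdaptedFrame D W x (U x) (s x) (g x) (c x)) {x q : X}
    (hx : q ∈ U x) : frameMatrix s c x x q = 1 := by
  ext j k
  rw [frameMatrix, Matrix.of_apply, (h x).isCoframeOn.apply_frame q hx]
  simp [Matrix.one_apply, Pi.single_apply]

theorem det_frameMatrix_ne_zero (h : ∀ x, IsAdaptedFrame D W x (U x) (s x) (g x) (c x)) {x y q : X}
    (hx : q ∈ U x) (hy : q ∈ U y) : (frameMatrix s c x y q).det ≠ 0 := by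
  have h1 := frameMatrix_mul h (x := x) hy hx
  rw [frameMatrix_self h hx] at h1
  have h2 := congrArg Matrix.det h1
  rw [Matrix.det_one, Matrix.det_mul] at h2
  exact left_ne_zero_of_mul_eq_one h2.symm

/-- The matrix of the connection in the frame around `x`. -/
def connMatrix (g : X → Fin r → ∀ y, E y) (c : X → ∀ y, E y →ₗ[ℂ] (Fin r → ℂ)) (x q : X) :
    Matrix (Fin r) (Fin r) ℂ := Matrix.of fun j k => c x q (g x k q) j

theorem contMDiffOn_frameMatrix (h : ∀ x, IsAdaptedFrame D W x (U x) (s x) (g x) (c x))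
    (x y : X) (j k : Fin r) :
    ContMDiffOn 𝓘(ℂ, ℂ) 𝓘(ℂ, ℂ) ω (fun q => frameMatrix s c x y q j k) (U x ∩ U y) :=
  (h x).isCoframeOn.contMDiffOn _ _ ((h x).isFrameOn.isOpen.inter (h y).isFrameOn.isOpen)
    inter_subset_left (((h y).isFrameOn.isHolSection k).mono inter_subset_right) j

/-- The transformation law of the connection matrices. -/
theorem connMatrix_change [VectorBundle ℂ (Fin n → ℂ) E]
    [IsManifold 𝓘(ℂ, ℂ) ω X]
    (h : ∀ x, IsAdaptedFrame D W x (U x) (s x) (g x) (c x)) {x y q : X}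
    (hx : q ∈ U x) (hy : q ∈ U y) (hqS : q ∉ S) :
    (pole S y (chartAt ℂ y q) * deriv (trans x y) (chartAt ℂ x q)) •
      (frameMatrix s c x y q * connMatrix g c y q) =
    pole S x (chartAt ℂ x q) • (connMatrix g c x q * frameMatrix s c x y q) +
      Matrix.of fun j k => deriv ((fun q => frameMatrix s c x y q j k) ∘ (chartAt ℂ x).symm)
        (chartAt ℂ x q) := by
  have hsx := (h x).subset hx
  have hsy := (h y).subset hy
  have hV : IsOpen (U x ∩ U y) := (h x).isFrameOn.isOpen.inter (h y).isFrameOn.isOpen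
  ext m k
  -- A member of the frame around y equals its expansion in the frame around x only on the overlap,
  -- so locality of D is needed before the Leibniz rule can be applied to the expansion.
  have hcongr := D.map_congr (U x ∩ U y) (s y k)
    (fun q => ∑ j, frameMatrix s c x y q j k • s x j q) hV
    (((h y).isFrameOn.isHolSection k).mono inter_subset_right)
    (isHolSection_sum _ (fun j => contMDiffOn_frameMatrix h x y j k)
      fun j => ((h x).isFrameOn.isHolSection j).mono inter_subset_left)
    (fun q hq => (h x).isFrameOn.eq_sum (h x).isCoframeOn hq.1 ((h y).isFrameOn.mem hq.2 k))
    q ⟨hx, hy⟩ hqS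
  rw [D.D_sum _ hV (fun j => contMDiffOn_frameMatrix h x y j k)
    (fun j => ((h x).isFrameOn.isHolSection j).mono inter_subset_left) ⟨hx, hy⟩ hqS,
    (h y).D_eq k q hy hqS] at hcongr
  have hev := congrArg (fun L => c x q (L (coordVec x q)) m) hcongr
  simp only [LinearMap.smulRight_apply, LinearMap.sum_apply, LinearMap.add_apply,
    LinearMap.smul_apply, (h x).D_eq _ q hx hqS, logGen_apply S hsx hsy, logGen_apply S hsx hsx,
    deriv_trans_self hsx, diff_apply hV (contMDiffOn_frameMatrix h x y _ k) (show q ∈ U x ∩ U y from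
      ⟨hx, hy⟩) hsx] at hev
  have hgy := (h y).isFrameOn.eq_sum (h y).isCoframeOn hy ((h y).mem_subbundle k q hy)
  rw [hgy] at hev
  simp only [map_sum, map_add, map_smul, Finset.sum_apply, Pi.add_apply, Pi.smul_apply,
    smul_eq_mul, (h x).isCoframeOn.apply_frame q hx, Finset.sum_add_distrib, mul_one] at hev
  simp only [Matrix.smul_apply, Matrix.add_apply, Matrix.mul_apply, smul_eq_mul, frameMatrix,
    connMatrix, Matrix.of_apply]
  refine Eq.trans ?_ (hev.trans ?_)
  · congr 1
    exact Finset.sum_congr rfl fun j _ => mul_comm _ _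
  · congr 1
    · rw [Finset.mul_sum]
      refine Finset.sum_congr rfl fun j _ => ?_
      simp only [frameMatrix, Matrix.of_apply]
      ring
    · rw [Finset.sum_eq_single m]
      · simp [frameMatrix]
      · intro j _ hj
        simp [Ne.symm hj]
      · simp

/-- This is det W with its induced connection: the transition functions are determinants of frame
changes, and the connection forms are traces of connection matrices. Taking the trace of the gauge
law gives their transformation law, with Jacobi's formula identifying the correction as dlog det. -/
theorem isLogLineData_of_frames [VectorBundle ℂ (Fin n → ℂ) E]
    [IsManifold 𝓘(ℂ, ℂ) ω X]
    (h : ∀ x, IsAdaptedFrame D W x (U x) (s x) (g x) (c x)) :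
    IsLogLineData S U (fun x y q => (frameMatrix s c x y q).det)
      (fun x z => (connMatrix g c x ((chartAt ℂ x).symm z)).trace) where
  isOpen x := (h x).isFrameOn.isOpen
  mem x := (h x).mem
  subset x := (h x).subset
  differentiableOn x := by
    rintro _ ⟨q, hq, rfl⟩
    refine DifferentiableAt.differentiableWithinAt (DifferentiableAt.fun_sum fun j _ => ?_)
    exact differentiableAt_comp_symm (h x).isFrameOn.isOpen ((h x).isCoframeOn.contMDiffOn _ _
      (h x).isFrameOn.isOpen le_rfl ((h x).isHolSection j) j) hq ((h x).subset hq)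
  differentiableOn_transition x y := by
    rintro _ ⟨q, hq, rfl⟩
    refine DifferentiableAt.differentiableWithinAt ?_
    exact differentiableAt_comp_symm ((h x).isFrameOn.isOpen.inter (h y).isFrameOn.isOpen)
      (contMDiffOn_det fun j k => contMDiffOn_frameMatrix h x y j k) hq ((h x).subset hq.1)
  ne_zero x y q hq := det_frameMatrix_ne_zero h hq.1 hq.2
  cocycle x y z q hq := by
    rw [frameMatrix_mul h hq.1.2 hq.2, Matrix.det_mul]
  change x y q hx hy hqS := by
    have hsx := (h x).subset hx
    have hV : IsOpen (U x ∩ U y) := (h x).isFrameOn.isOpen.inter (h y).isFrameOn.isOpen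
    have h1 := trace_gauge (det_frameMatrix_ne_zero h hx hy) (connMatrix_change h hx hy hqS)
    have h2 : HasDerivAt (fun z => (frameMatrix s c x y ((chartAt ℂ x).symm z)).det)
        ((frameMatrix s c x y ((chartAt ℂ x).symm (chartAt ℂ x q))).adjugate *
          Matrix.of fun j k => deriv ((fun q => frameMatrix s c x y q j k) ∘ (chartAt ℂ x).symm)
            (chartAt ℂ x q)).trace (chartAt ℂ x q) := hasDerivAt_det fun j k =>
      (differentiableAt_comp_symm hV (contMDiffOn_frameMatrix h x y j k) ⟨hx, hy⟩ hsx).hasDerivAt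
    have h3 := h2.deriv
    rw [(chartAt ℂ x).left_inv hsx] at h3
    have h4 : deriv ((fun q => (frameMatrix s c x y q).det) ∘ (chartAt ℂ x).symm)
      (chartAt ℂ x q) = _ := h3
    rw [h4, (chartAt ℂ x).left_inv hsx, (chartAt ℂ y).left_inv ((h y).subset hy)]
    linear_combination h1

/-- A scalar residue multiplies each frame vector at x by l, so the connection matrix at x is l
times the identity of size r, whatever the subbundle. -/
theorem trace_connMatrix_of_hasResidue (h : ∀ x, IsAdaptedFrame D W x (U x) (s x) (g x) (c x))
    {x : X} {l : ℂ} (hres : D.HasResidue x (l • LinearMap.id)) :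
    (connMatrix g c x ((chartAt ℂ x).symm (chartAt ℂ x x))).trace = r * l := by
  rw [(chartAt ℂ x).left_inv (mem_chart_source ℂ x)]
  have h1 (k : Fin r) : g x k x = l • s x k x :=
    (hres (U x) (s x k) (g x k) (h x).isFrameOn.isOpen (h x).mem
      ((h x).isFrameOn.isHolSection k) ((h x).isHolSection k) ((h x).D_eq k)).symm
  simp [connMatrix, Matrix.trace, h1, (h x).isCoframeOn.apply_frame x (h x).mem]

/-- When the frames come from the preferred trivializations, their coordinate maps are those
trivializations. The frame matrix is then the bundle's transition map, and its determinant acts on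
the top exterior power. -/
theorem detCoord_eq_mul [VectorBundle ℂ (Fin n → ℂ) E]
    (h : ∀ x, IsAdaptedFrame D (fun _ => ⊤) x (U x) (s x) (g x) (c x))
    (hr : r = n) (hs : ∀ x, ∀ q ∈ U x, q ∈ (trivializationAt (Fin n → ℂ) E x).baseSet ∧
      ∀ k, (trivializationAt (Fin n → ℂ) E x).linearMapAt ℂ q (s x k q) = Pi.single (Fin.cast hr k) 1)
    (σ : ∀ y, ⋀[ℂ]^n (E y)) {x y q : X} (hx : q ∈ U x) (hy : q ∈ U y) :
    detCoord n σ x q = (frameMatrix s c x y q).det * detCoord n σ y q := by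
  subst hr
  simp only [Fin.cast_refl, id] at hs
  have hc : ∀ x, ∀ q ∈ U x, (trivializationAt (Fin r → ℂ) E x).linearMapAt ℂ q = c x q := by
    intro x q hq
    refine LinearMap.ext fun v => ?_
    rw [(h x).isFrameOn.eq_sum (h x).isCoframeOn hq (Submodule.mem_top (x := v))]
    simp only [map_sum, map_smul, (hs x q hq).2, (h x).isCoframeOn.apply_frame q hq]
  have hlin : c x q = (Matrix.toLin' (frameMatrix s c x y q)).comp (c y q) := by
    refine LinearMap.ext fun v => ?_
    conv_lhs => rw [(h y).isFrameOn.eq_sum (h y).isCoframeOn hy (Submodule.mem_top (x := v))]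
    funext j
    simp [frameMatrix, Matrix.mulVec, dotProduct, mul_comm]
  rw [detCoord, detCoord, hc x q hx, hc y q hy, hlin, exteriorPower.map_comp,
    LinearMap.comp_apply, det_exteriorPower_map, LinearMap.toMatrix'_toLin']

end LineDataOfFrames

end Connection

/-! ### Residue sums of preserved subbundles and the degree of E. -/

section Irreducible

variable {X : Type*} [TopologicalSpace X] [ChartedSpace ℂ X] {n : ℕ} {E : X → Type*}
  [∀ x, AddCommGroup (E x)] [∀ x, Module ℂ (E x)] [∀ x, TopologicalSpace (E x)]
  [TopologicalSpace (TotalSpace (Fin n → ℂ) E)] [FiberBundle (Fin n → ℂ) E]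

theorem IsFrameOn.finrank_eq {W : ∀ x, Submodule ℂ (E x)} {r : ℕ} {U : Set X}
    {s : Fin r → ∀ y, E y} (h : IsFrameOn n W U s) {y : X} (hy : y ∈ U) :
    Module.finrank ℂ (W y) = r := by
  rw [← h.span_eq y hy, finrank_span_eq_card (h.linearIndependent y hy), Fintype.card_fin]

/-- A holomorphic subbundle over a connected base has constant rank. -/
theorem IsHolSubbundle.exists_frames [ConnectedSpace X] {W : ∀ x, Submodule ℂ (E x)}
    (hW : IsHolSubbundle n W) :
    ∃ r : ℕ, (∀ x, Module.finrank ℂ (W x) = r) ∧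
      ∀ x, ∃ (U : Set X) (s : Fin r → ∀ y, E y), x ∈ U ∧ IsFrameOn n W U s := by
  have hframe (x : X) : ∃ (r : ℕ) (U : Set X) (s : Fin r → ∀ y, E y),
      x ∈ U ∧ IsFrameOn n W U s := by
    obtain ⟨U, r, s, hU, hx, hs, h⟩ := hW x
    exact ⟨r, U, s, hx, hU, hs, fun y hy => (h y hy).1, fun y hy => (h y hy).2⟩
  have hloc : IsLocallyConstant fun x => Module.finrank ℂ (W x) := by
    refine (IsLocallyConstant.iff_eventually_eq _).2 fun x => ?_
    obtain ⟨r, U, s, hx, h⟩ := hframe x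
    filter_upwards [h.isOpen.mem_nhds hx] with y hy
    rw [h.finrank_eq hy, h.finrank_eq hx]
  obtain ⟨x₀⟩ : Nonempty X := inferInstance
  have hconst (x : X) : Module.finrank ℂ (W x) = Module.finrank ℂ (W x₀) :=
    hloc.apply_eq_of_preconnectedSpace x x₀
  refine ⟨_, hconst, fun x => ?_⟩
  obtain ⟨r, U, s, hx, h⟩ := hframe x
  have hr : r = Module.finrank ℂ (W x₀) := by rw [← hconst x, h.finrank_eq hx]
  subst hr
  exact ⟨U, s, hx, h⟩

theorem LogConnection.preserves_top {S : Finset X} (D : LogConnection n E S) :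
    D.Preserves fun _ => ⊤ :=
  fun U s hU hs _ => D.isLogForm U s hU hs

variable [VectorBundle ℂ (Fin n → ℂ) E] [ContMDiffVectorBundle ω (Fin n → ℂ) E 𝓘(ℂ, ℂ)]

theorem isFrameOn_trivializationAt (x : X) :
    IsFrameOn n (fun y : X => (⊤ : Submodule ℂ (E y)))
      (trivializationAt (Fin n → ℂ) E x).baseSet
      fun k y => (trivializationAt (Fin n → ℂ) E x).symm y (Pi.single k 1) := by
  set e := trivializationAt (Fin n → ℂ) E x with he
  have hb (y : X) (hy : y ∈ e.baseSet) : (fun k : Fin n => e.symm y (Pi.single k 1)) =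
      (Pi.basisFun ℂ (Fin n)).map (e.linearEquivAt ℂ y hy).symm := by
    funext k
    rw [Module.Basis.map_apply, Pi.basisFun_apply]
    rfl
  refine ⟨e.open_baseSet, fun k => ?_, fun y hy => ?_, fun y hy => ?_⟩
  · refine (e.contMDiffOn_section_baseSet_iff).2 (ContMDiffOn.congr
      (contMDiffOn_const (c := (Pi.single k 1 : Fin n → ℂ))) fun y hy => ?_)
    rw [Trivialization.apply_mk_symm e hy]
  · rw [hb y hy]
    exact Module.Basis.linearIndependent _
  · rw [hb y hy]
    exact Module.Basis.span_eq _

variable [T2Space X] [CompactSpace X] [IsManifold 𝓘(ℂ, ℂ) ω X]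

/-- The residues of a connection with scalar residues, summed over a preserved subbundle. -/
theorem exists_mul_sum_eq_intCast {S : Finset X} {D : LogConnection n E S}
    {W : ∀ x, Submodule ℂ (E x)} (hD : D.Preserves W) {r : ℕ}
    (hW : ∀ x, ∃ (U : Set X) (s : Fin r → ∀ y, E y), x ∈ U ∧ IsFrameOn n W U s) {l : X → ℂ}
    (hres : ∀ x ∈ S, D.HasResidue x (l x • LinearMap.id)) :
    ∃ k : ℤ, (r : ℂ) * ∑ x ∈ S, l x = k := by
  choose U s hx hU using hW
  choose V g c hVU h using fun x => (hU x).exists_adapted hD (hx x)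
  obtain ⟨k, hk⟩ := (isLogLineData_of_frames h).exists_sum_eq_intCast
  refine ⟨k, hk ▸ ?_⟩
  rw [Finset.mul_sum]
  exact Finset.sum_congr rfl fun x hxS => (trace_connMatrix_of_hasResidue h (hres x hxS)).symm

/-- The degree of a bundle is minus the sum of the traces of the residues of a connection. -/
theorem IsDegree.add_mul_sum {S : Finset X} {d : ℤ} (hd : IsDegree n E d) (D : LogConnection n E S)
    {l : X → ℂ} (hres : ∀ x ∈ S, D.HasResidue x (l x • LinearMap.id)) :
    (d : ℂ) + n * ∑ x ∈ S, l x = 0 := by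
  obtain ⟨σ, hσ, rfl⟩ := hd
  choose V g c hVU h using fun x => (isFrameOn_trivializationAt (n := n) (E := E) x).exists_adapted
    D.preserves_top (mem_baseSet_trivializationAt _ _ x)
  -- The frames are those of the preferred trivializations, because the definition of the degree
  -- measures orders in exactly these coordinates.
  have hs (x q : X) (hq : q ∈ V x) : q ∈ (trivializationAt (Fin n → ℂ) E x).baseSet ∧
      ∀ k, (trivializationAt (Fin n → ℂ) E x).linearMapAt ℂ q
        ((trivializationAt (Fin n → ℂ) E x).symm q (Pi.single k 1)) =
          Pi.single (Fin.cast rfl k) 1 := by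
    refine ⟨hVU x hq, fun k => ?_⟩
    rw [Trivialization.linearMapAt_def_of_mem _ (hVU x hq)]
    exact (((trivializationAt (Fin n → ℂ) E x).linearEquivAt ℂ q (hVU x hq)).apply_symm_apply _)
  have h1 := (isLogLineData_of_frames h).finsum_order_add_sum (f := detCoord n σ)
    (fun x y q hq => detCoord_eq_mul h rfl hs σ hq.1 hq.2) (fun x => (hσ x).1) fun x => (hσ x).2
  refine Eq.trans ?_ h1
  rw [Finset.mul_sum]
  exact congrArg₂ _ rfl (Finset.sum_congr rfl fun x hxS =>
    (trace_connMatrix_of_hasResidue h (hres x hxS)).symm)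

end Irreducible

end LogConn

end

/-! ### Irreducibility from coprimality of rank and degree. -/

theorem mainTheorem12
    {X : Type*} [TopologicalSpace X] [T2Space X] [CompactSpace X] [ConnectedSpace X]
    [ChartedSpace ℂ X] [IsManifold 𝓘(ℂ, ℂ) ω X]
    (S : Finset X) (n : ℕ) (hn : 1 ≤ n)
    (E : X → Type*) [∀ x, AddCommGroup (E x)] [∀ x, Module ℂ (E x)]
    [∀ x, TopologicalSpace (E x)] [TopologicalSpace (TotalSpace (Fin n → ℂ) E)]
    [FiberBundle (Fin n → ℂ) E] [VectorBundle ℂ (Fin n → ℂ) E]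
    [ContMDiffVectorBundle ω (Fin n → ℂ) E 𝓘(ℂ, ℂ)]
    (d : ℤ) (hd : LogConn.degree n E = d) (hnd : IsCoprime (n : ℤ) d)
    (c : X → ℂ) (D : LogConn.LogConnection n E S)
    (hres : ∀ x ∈ S, D.HasResidue x (c x • LinearMap.id)) :
    D.Irreducible := by
  classical
  intro W hW hD
  obtain ⟨r, hr, hframes⟩ := hW.exists_frames
  let φ (x : X) : E x ≃ₗ[ℂ] (Fin n → ℂ) := (trivializationAt (Fin n → ℂ) E x).linearEquivAt ℂ x
    (FiberBundle.mem_baseSet_trivializationAt _ _ x)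
  have hfin (x : X) : Module.Finite ℂ (E x) := Module.Finite.equiv (φ x).symm
  have hrank (x : X) : Module.finrank ℂ (E x) = n := by
    rw [(φ x).finrank_eq, Module.finrank_fin_fun]
  suffices r = 0 ∨ r = n by
    refine this.imp (fun h x => ?_) fun h x => ?_
    · exact Submodule.finrank_eq_zero.1 ((hr x).trans h)
    · exact Submodule.eq_top_of_finrank_eq (((hr x).trans h).trans (hrank x).symm)
  have hrn : r ≤ n := by
    obtain ⟨x⟩ : Nonempty X := inferInstance
    exact hr x ▸ hrank x ▸ Submodule.finrank_le (W x)
  by_cases hdeg : ∃ d, LogConn.IsDegree n E d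
  · have hdd : LogConn.IsDegree n E d := by
      rw [← hd, LogConn.degree, dif_pos hdeg]
      exact hdeg.choose_spec
    have h1 := hdd.add_mul_sum D hres
    obtain ⟨k, hk⟩ := LogConn.exists_mul_sum_eq_intCast hD hframes hres
    -- With s the sum of the λ_j, the relations d + n s = 0 and r s = k eliminate s. The resulting
    -- identity of integers is read off in ℂ.
    have h2 : (r : ℤ) * d = n * (-k) := by
      have : (r : ℂ) * d = n * (-k) := by linear_combination (r : ℂ) * h1 - (n : ℂ) * hk
      exact_mod_cast this
    have h3 : (n : ℤ) ∣ r := hnd.dvd_of_dvd_mul_right ⟨_, h2⟩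
    rcases Nat.eq_zero_or_pos r with h0 | h0
    · exact Or.inl h0
    · exact Or.inr (hrn.antisymm (Nat.le_of_dvd h0 (Int.natCast_dvd_natCast.1 h3)))
  -- Without a nonzero meromorphic section of the determinant the degree takes its default value 0.
  -- Coprimality with 0 forces n = 1, and r ≤ 1 leaves only the two trivial ranks.
  · rw [LogConn.degree, dif_neg hdeg] at hd
    rw [← hd, isCoprime_zero_right, Int.ofNat_isUnit, Nat.isUnit_iff] at hnd
    omega
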